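/- Let $\mathbb{R}^\infty=\bigcup_k\mathbb{R}^k$, $\mathbb{Z}^\infty=\bigcup_k\mathbb{Z}^k$, $\mathbb{Q}^\infty=\bigcup_k\mathbb{Q}^k$, and let $Q$ be an inner product on $\mathbb{R}^\infty$ with $Q(\mathbb{Z}^\infty\times\mathbb{Z}^\infty)\subset\mathbb{Q}$. A lattice cone is a pair $(C,\Lambda_C)$, where $C$ is a strongly convex cone (i.e. $C\cap(-C)=\{0\}$) generated by finitely many vectors of $\mathbb{Q}^\infty$ and $\Lambda_C\subset\mathbb{Q}^\infty$ is a finitely generated subgroup that spans the same linear subspace $\mathrm{lin}(C)$ of $\mathbb{R}^\infty$ as $C$. Let $\mathcal{C}$ be the set of lattice cones and $\mathbb{Q}\mathcal{C}$ the $\mathbb{Q}$-vector space with basis $\mathcal{C}$. Write $(C,\Lambda_C)\perp^Q(D,\Lambda_D)$ if $Q(u,v)=0$ for all $u\in\Lambda_C$, $v\in\Lambda_D$; for $x,y\in\mathbb{Q}\mathcal{C}$ write $x\perp^Q y$ if every basis element occurring in $x$ is orthogonal to every basis element occurring in $y$. On pairs $x\perp^Q y$ define the product $x\cdot y$ by bilinear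 extension of the Minkowski product $(C,\Lambda_C)\cdot(D,\Lambda_D)=(C+D,\Lambda_C+\Lambda_D)$ of orthogonal lattice cones; let the unit $1$ be $(\{0\},\{0\})$, and $u(k)=k\cdot 1$ for $k\in\mathbb{Q}$. Define linear maps $$\Delta(C,\Lambda_C)=\sum_{F}t\big((C,\Lambda_C),(F,\Lambda_F)\big)\otimes(F,\Lambda_F),\qquad \varepsilon(C,\Lambda_C)=\begin{cases}1,&(C,\Lambda_C)=(\{0\},\{0\}),\\0,&\text{otherwise,}\end{cases}$$ where $F$ runs over all faces of $C$ (including $\{0\}$ and $C$), $\Lambda_F=\Lambda_C\cap\mathrm{lin}(F)$, and $t((C,\Lambda_C),(F,\Lambda_F))$ is the image of $(C,\Lambda_C)$ under the $Q$-orthogonal projection to the orthogonal subspace of $\mathrm{lin}(F)$. Then $(\mathbb{Q}\mathcal{C},\perp^Q,\cdot,u,\Delta,\varepsilon)$ is a locality Hopf algebra. Explicitly, with $B=\mathbb{Q}\mathcal{C}$, $\top=\;\perp^Q$ and $U^\top=\{x\in B: v\top x\text{ for all }v\in U\}$ for $U\subseteq B$: 1. (Locality algebra) $\top$ is symmetric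 and every $U^\top$ is a linear subspace; the product is bilinear whenever all pairs involved are related, it is commutative, $x\cdot y\in U^\top$ for $x,y\in U^\top$ with $x\top y$, $(x\cdot y)\cdot z=x\cdot(y\cdot z)$ for pairwise related $x,y,z$, $\{1\}^\top=B$ and $x\cdot 1=1\cdot x=x$. 2. (Locality coalgebra) $\Delta$ is coassociative with counit $\varepsilon$, and for every $U\subseteq B$ one has $\Delta(U^\top)\subseteq U^\top\otimes_\top U^\top$, the span of all $a\otimes b$ with $a,b\in U^\top$ and $a\top b$. 3. (Compatibility) $\Delta:B\to B\otimes_\top B$ and $\varepsilon:B\to\mathbb{Q}$ are unital locality algebra homomorphisms: $\Delta(1)=1\otimes 1$, $\varepsilon(1)=1$, and if $x\top y$, then $\varepsilon(x\cdot y)=\varepsilon(x)\varepsilon(y)$, one can write $\Delta(x)=\sum_i a_i\otimes b_i$ and $\Delta(y)=\sum_j c_j\otimes d_j$ as finite sums such that $a_i\top b_i$ for all $i$, $c_j\top d_j$ for all $j$, and $a_i,b_i,c_j,d_j$ are pairwise related for all $i,j$, and $\Delta(x\cdot y)=\sum_{i,j}(a_i\cdot c_j)\otimes(b_i\cdot d_j)$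 for all such expressions. 4. (Antipode) There is a linear map $S:B\to B$ such that $S$ and $\mathrm{Id}$ are mutually independent, i.e. $x\top y$ implies $S(x)\top y$ and $x\top S(y)$, and $S\star\mathrm{Id}=\mathrm{Id}\star S=u\circ\varepsilon$, i.e. $\sum_i S(a_i)\cdot b_i=\sum_i a_i\cdot S(b_i)=\varepsilon(x)1$ whenever $\Delta(x)=\sum_i a_i\otimes b_i$ is a finite sum with $a_i\top b_i$ for all $i$. -/

import Mathlib

open scoped TensorProduct

namespace LocalityCone

noncomputable section

/-! ### Locality structures

A locality relation on `X` is a relation `top : X → X → Prop`, and a partial product defined exactly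
on related pairs is a function `mul : ∀ x y, top x y → X`. -/

/-- The polar subset of `U`: the elements that are related to all elements of `U`. -/
def polar {X : Type*} (top : X → X → Prop) (U : Set X) : Set X :=
  {x | ∀ u ∈ U, top u x}

/-- Locality semigroup: a symmetric relation with a product on related pairs that is compatible
with the relation and associative on pairwise related triples. In `assoc`, the proofs `h₁` and `h₂`
that the two outer products are defined always exist, by `mul_mem_polar`. -/
structure IsLocalitySemigroup {G : Type*} (top : G → G → Prop)
    (mul : ∀ x y : G, top x y → G) : Prop where
  symm : ∀ x y, top x y → top y x
  mul_mem_polar : ∀ (U : Set G) (x y : G) (h : top x y),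
    x ∈ polar top U → y ∈ polar top U → mul x y h ∈ polar top U
  assoc : ∀ (x y z : G) (hxy : top x y) (hyz : top y z) (_ : top x z)
    (h₁ : top (mul x y hxy) z) (h₂ : top x (mul y z hyz)),
    mul (mul x y hxy) z h₁ = mul x (mul y z hyz) h₂

/-- Locality monoid: a locality semigroup with a unit, which is related to every element. -/
structure IsLocalityMonoid {G : Type*} (top : G → G → Prop)
    (mul : ∀ x y : G, top x y → G) (one : G) : Prop
    extends IsLocalitySemigroup top mul where
  polar_one : polar top {one} = Set.univ
  mul_one : ∀ (x : G) (h : top x one), mul x one h = x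
  one_mul : ∀ (x : G) (h : top one x), mul one x h = x

/-- Locality vector space: the relation is symmetric, and polar subsets are linear subspaces. -/
structure IsLocalityVectorSpace (K : Type*) {V : Type*} [Field K] [AddCommGroup V] [Module K V]
    (top : V → V → Prop) : Prop where
  symm : ∀ x y, top x y → top y x
  polar_subspace : ∀ X : Set V, ∃ W : Submodule K V, (W : Set V) = polar top X

/-- Locality bilinearity of a map that is defined on related pairs: each identity holds whenever
all the pairs in it are related. -/
structure IsLocalityBilinear (K : Type*) {V U : Type*} [Field K] [AddCommGroup V] [Module K V]
    [AddCommGroup U] [Module K U] (top : V → V → Prop) (f : ∀ x y : V, top x y → U) : Prop where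
  add_left : ∀ (v₁ v₂ w : V) (h : top (v₁ + v₂) w) (h₁ : top v₁ w) (h₂ : top v₂ w),
    f (v₁ + v₂) w h = f v₁ w h₁ + f v₂ w h₂
  add_right : ∀ (v w₁ w₂ : V) (h : top v (w₁ + w₂)) (h₁ : top v w₁) (h₂ : top v w₂),
    f v (w₁ + w₂) h = f v w₁ h₁ + f v w₂ h₂
  smul_left : ∀ (k : K) (v w : V) (h : top (k • v) w) (h₁ : top v w),
    f (k • v) w h = k • f v w h₁
  smul_right : ∀ (k : K) (v w : V) (h : top v (k • w)) (h₁ : top v w),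
    f v (k • w) h = k • f v w h₁

/-- (Commutative, unitary) locality algebra over `K`. The unit map is `k ↦ k • one`. -/
structure IsLocalityAlgebra (K : Type*) {A : Type*} [Field K] [AddCommGroup A] [Module K A]
    (top : A → A → Prop) (mul : ∀ x y : A, top x y → A) (one : A) : Prop where
  vectorSpace : IsLocalityVectorSpace K top
  bilinear : IsLocalityBilinear K top mul
  monoid : IsLocalityMonoid top mul one
  comm : ∀ (x y : A) (h : top x y) (h' : top y x), mul x y h = mul y x h'

/-- The locality tensor product of two subsets `S`, `T` of `V`, inside `V ⊗ V`: the span of the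
pure tensors `a ⊗ b` with `a ∈ S`, `b ∈ T` and `a` related to `b`. -/
def locTensor (K : Type*) {V : Type*} [Field K] [AddCommGroup V] [Module K V]
    (top : V → V → Prop) (S T : Set V) : Submodule K (V ⊗[K] V) :=
  Submodule.span K {t | ∃ a ∈ S, ∃ b ∈ T, top a b ∧ t = a ⊗ₜ[K] b}

/-- Locality coalgebra: a coassociative counital coalgebra on a locality vector space whose
coproduct maps `Uᵀ` to `Uᵀ ⊗_⊤ Uᵀ` for every subset `U`. -/
structure IsLocalityCoalgebra (K : Type*) {C : Type*} [Field K] [AddCommGroup C] [Module K C]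
    (top : C → C → Prop) (Δ : C →ₗ[K] C ⊗[K] C) (ε : C →ₗ[K] K) : Prop where
  vectorSpace : IsLocalityVectorSpace K top
  comul_mem : ∀ (U : Set C), ∀ c ∈ polar top U,
    Δ c ∈ locTensor K top (polar top U) (polar top U)
  coassoc : ∀ c, TensorProduct.assoc K C C C ((Δ.rTensor C) (Δ c)) = (Δ.lTensor C) (Δ c)
  counit_left : ∀ c, TensorProduct.lid K C ((ε.rTensor C) (Δ c)) = c
  counit_right : ∀ c, TensorProduct.rid K C ((ε.lTensor C) (Δ c)) = c

/-- For families `a i ⊗ b i` and `c j ⊗ d j` of pure tensors: each quadruple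
`(a i, b i, c j, d j)` consists of pairwise related elements (and the pairs `(a i, b i)` and
`(c j, d j)` are related even if the other family is empty). -/
def IndepTensors {B : Type*} (top : B → B → Prop) {m n : ℕ} (a b : Fin m → B)
    (c d : Fin n → B) : Prop :=
  (∀ i, top (a i) (b i)) ∧ (∀ j, top (c j) (d j)) ∧
    ∀ i j, top (a i) (c j) ∧ top (a i) (d j) ∧ top (b i) (c j) ∧ top (b i) (d j)

/-- The locality relation on `B ⊗_⊤ B`: two tensors are related if they can be written as sums of
pure tensors `a i ⊗ b i` and `c j ⊗ d j` with all `(a i, b i, c j, d j)` pairwise related. -/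
def tensorTop (K : Type*) {B : Type*} [Field K] [AddCommGroup B] [Module K B]
    (top : B → B → Prop) (s t : B ⊗[K] B) : Prop :=
  ∃ (m n : ℕ) (a b : Fin m → B) (c d : Fin n → B), IndepTensors top a b c d ∧
    s = ∑ i, a i ⊗ₜ[K] b i ∧ t = ∑ j, c j ⊗ₜ[K] d j

/-- Locality bialgebra: a locality algebra and locality coalgebra such that `Δ : B → B ⊗_⊤ B` and
`ε : B → K` are (unital) locality algebra homomorphisms. The product of `∑ a i ⊗ b i` and
`∑ c j ⊗ d j` is `∑ (a i * c j) ⊗ (b i * d j)`; `comul_mul` asks for the multiplicativity of `Δ`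
with every admissible way of writing the coproducts as sums of pure tensors (and `comul_top`
provides at least one). The ground field carries the full locality relation, so there is no
locality condition on `ε`. -/
structure IsLocalityBialgebra (K : Type*) {B : Type*} [Field K] [AddCommGroup B] [Module K B]
    (top : B → B → Prop) (mul : ∀ x y : B, top x y → B) (one : B)
    (Δ : B →ₗ[K] B ⊗[K] B) (ε : B →ₗ[K] K) : Prop where
  algebra : IsLocalityAlgebra K top mul one
  coalgebra : IsLocalityCoalgebra K top Δ ε
  comul_top : ∀ x y, top x y → tensorTop K top (Δ x) (Δ y)
  comul_mul : ∀ (x y : B) (h : top x y) (m n : ℕ) (a b : Fin m → B) (c d : Fin n → B)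
    (H : IndepTensors top a b c d),
    Δ x = ∑ i, a i ⊗ₜ[K] b i → Δ y = ∑ j, c j ⊗ₜ[K] d j →
    Δ (mul x y h) = ∑ i, ∑ j,
      mul (a i) (c j) (H.2.2 i j).1 ⊗ₜ[K] mul (b i) (d j) (H.2.2 i j).2.2.2
  comul_one : Δ one = one ⊗ₜ[K] one
  counit_mul : ∀ (x y : B) (h : top x y), ε (mul x y h) = ε x * ε y
  counit_one : ε one = 1

/-- Two maps are independent if they send related pairs to related pairs. -/
def Independent {X Y : Type*} (topX : X → X → Prop) (topY : Y → Y → Prop) (φ ψ : X → Y) : Prop :=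
  ∀ x y, topX x y → topY (φ x) (ψ y)

/-- `φ ⋆ ψ = χ` for the convolution product `m ∘ (φ ⊗ ψ) ∘ Δ` of two independent maps, where the
coproduct of `x` may be written in any way as a sum of pure tensors `a i ⊗ b i` with `a i` related
to `b i` (there is at least one such way in a locality coalgebra). -/
def IsConvolution (K : Type*) {B : Type*} [Field K] [AddCommGroup B] [Module K B]
    (top : B → B → Prop) (mul : ∀ x y : B, top x y → B) (Δ : B →ₗ[K] B ⊗[K] B)
    (φ ψ : B →ₗ[K] B) (h : Independent top top φ ψ) (χ : B →ₗ[K] B) : Prop :=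
  ∀ (x : B) (n : ℕ) (a b : Fin n → B) (H : ∀ i, top (a i) (b i)),
    Δ x = ∑ i, a i ⊗ₜ[K] b i →
    ∑ i, mul (φ (a i)) (ψ (b i)) (h (a i) (b i) (H i)) = χ x

/-- Antipode: a linear map `S` such that `S` and `Id` are mutually independent and
`S ⋆ Id = Id ⋆ S = u ∘ ε`. -/
def IsAntipode (K : Type*) {B : Type*} [Field K] [AddCommGroup B] [Module K B]
    (top : B → B → Prop) (mul : ∀ x y : B, top x y → B) (one : B)
    (Δ : B →ₗ[K] B ⊗[K] B) (ε : B →ₗ[K] K) (S : B →ₗ[K] B) : Prop :=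
  ∃ (h : Independent top top S (LinearMap.id : B →ₗ[K] B))
    (h' : Independent top top (LinearMap.id : B →ₗ[K] B) S),
    IsConvolution K top mul Δ S LinearMap.id h (ε.smulRight one) ∧
    IsConvolution K top mul Δ LinearMap.id S h' (ε.smulRight one)

/-- Locality Hopf algebra: a locality bialgebra with an antipode. -/
structure IsLocalityHopfAlgebra (K : Type*) {B : Type*} [Field K] [AddCommGroup B] [Module K B]
    (top : B → B → Prop) (mul : ∀ x y : B, top x y → B) (one : B)
    (Δ : B →ₗ[K] B ⊗[K] B) (ε : B →ₗ[K] K) : Prop where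
  bialgebra : IsLocalityBialgebra K top mul one Δ ε
  exists_antipode : ∃ S : B →ₗ[K] B, IsAntipode K top mul one Δ ε S

/-- The linear extension of a relation on `X` to the vector space `K X` spanned by `X`: all basis
elements occurring in `x` are related to all basis elements occurring in `y`. -/
def freeTop {K X : Type*} [Field K] (top : X → X → Prop) (x y : X →₀ K) : Prop :=
  ∀ c ∈ x.support, ∀ d ∈ y.support, top c d

/-! ### The filtered rational Euclidean lattice space -/

/-- `ℝ^∞ = ⋃ ℝ^k`: the real sequences with finite support. -/
abbrev RInf : Type := ℕ →₀ ℝ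

/-- The vectors of `ℚ^∞ = ⋃ ℚ^k`. -/
def IsRational (v : RInf) : Prop := ∀ i, ∃ q : ℚ, v i = (q : ℝ)

/-- An inner product on `ℝ^∞` (that is, a compatible family of inner products on the `ℝ^k`) that
takes rational values on `ℤ^∞` (equivalently, on pairs of standard basis vectors). -/
structure RatInnerProduct where
  form : LinearMap.BilinForm ℝ RInf
  symm : ∀ x y, form x y = form y x
  pos : ∀ x, x ≠ 0 → 0 < form x x
  rational : ∀ i j : ℕ, ∃ q : ℚ, form (Finsupp.single i 1) (Finsupp.single j 1) = (q : ℝ)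

/-- A (strongly convex) lattice cone in `ℝ^∞`: a strongly convex cone generated by finitely many
rational vectors, together with a lattice of rational vectors in its linear span. -/
@[ext]
structure LatticeCone where
  cone : PointedCone ℝ RInf
  lattice : Submodule ℤ RInf
  polyhedral : ∃ s : Finset RInf, (∀ u ∈ s, IsRational u) ∧ cone = PointedCone.hull ℝ s
  salient : ∀ x ∈ cone, -x ∈ cone → x = 0
  lattice_rational : ∀ u ∈ lattice, IsRational u
  lattice_fg : lattice.FG
  span_lattice : Submodule.span ℝ (lattice : Set RInf) = Submodule.span ℝ (cone : Set RInf)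

/-! ### Rationality lemmas -/

lemma IsRational.zero : IsRational 0 := fun i => ⟨0, by simp⟩

lemma IsRational.add {u v : RInf} (hu : IsRational u) (hv : IsRational v) :
    IsRational (u + v) := fun i => by
  obtain ⟨a, ha⟩ := hu i
  obtain ⟨b, hb⟩ := hv i
  exact ⟨a + b, by simp [ha, hb]⟩

lemma IsRational.smul {u : RInf} (q : ℚ) (hu : IsRational u) :
    IsRational ((q : ℝ) • u) := fun i => by
  obtain ⟨a, ha⟩ := hu i
  exact ⟨q * a, by simp [ha]⟩

lemma IsRational.sub {u v : RInf} (hu : IsRational u) (hv : IsRational v) :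
    IsRational (u - v) := by
  have h := hu.add (hv.smul (-1))
  simpa [sub_eq_add_neg] using h

lemma RatInnerProduct.rational_form (Q : RatInnerProduct) {u v : RInf} (hu : IsRational u)
    (hv : IsRational v) : ∃ q : ℚ, Q.form u v = (q : ℝ) := by
  choose a ha using hu
  choose b hb using hv
  choose g hg using Q.rational
  refine ⟨∑ i ∈ u.support, ∑ j ∈ v.support, a i * b j * g i j, ?_⟩
  have hu' : u = ∑ i ∈ u.support, u i • Finsupp.single i (1 : ℝ) := by
    conv_lhs => rw [← Finsupp.sum_single u]
    simp [Finsupp.sum]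
  have hv' : v = ∑ i ∈ v.support, v i • Finsupp.single i (1 : ℝ) := by
    conv_lhs => rw [← Finsupp.sum_single v]
    simp [Finsupp.sum]
  conv_lhs => rw [hu', hv']
  push_cast
  simp only [map_sum, LinearMap.sum_apply, map_smul, LinearMap.smul_apply, smul_eq_mul, hg, ha, hb]
  simp only [Finset.mul_sum]
  rw [Finset.sum_comm]
  refine Finset.sum_congr rfl fun i _ => Finset.sum_congr rfl fun j _ => ?_
  ring

/-- A rational vector in the real span of a group `Λ` of rational vectors has a nonzero integer
multiple in `Λ`. -/
lemma exists_smul_mem_of_mem_span (Λ : Submodule ℤ RInf) (hΛ : ∀ u ∈ Λ, IsRational u)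
    {u : RInf} (hu : IsRational u) (h : u ∈ Submodule.span ℝ (Λ : Set RInf)) :
    ∃ n : ℤ, n ≠ 0 ∧ n • u ∈ Λ := by
  have hinj : LinearMap.ker (Algebra.linearMap ℚ ℝ) = ⊥ :=
    LinearMap.ker_eq_bot.2 (algebraMap ℚ ℝ).injective
  obtain ⟨r, hr⟩ := LinearMap.exists_leftInverse_of_injective (Algebra.linearMap ℚ ℝ) hinj
  have hr' : ∀ q : ℚ, r (q : ℝ) = q := fun q => by
    simpa using congrArg (fun f => f q) hr
  let ρ : RInf →ₗ[ℚ] RInf := Finsupp.mapRange.linearMap ((Algebra.linearMap ℚ ℝ) ∘ₗ r)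
  have hρ : ∀ (c : ℝ) (x : RInf), IsRational x → ρ (c • x) = (r c) • x := by
    intro c x hx
    ext i
    obtain ⟨q, hq⟩ := hx i
    have h1 : c * (q : ℝ) = q • c := by rw [Rat.smul_def, mul_comm]
    simp only [ρ, Finsupp.mapRange.linearMap_apply, Finsupp.mapRange_apply, Finsupp.smul_apply,
      hq, smul_eq_mul, h1, LinearMap.comp_apply, map_smul, Algebra.linearMap_apply]
    simp [Rat.smul_def, mul_comm]
  have key : ∀ x ∈ Submodule.span ℝ (Λ : Set RInf), ∀ c : ℝ,
      ρ (c • x) ∈ Submodule.span ℚ (Λ : Set RInf) := by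
    intro x hx
    induction hx using Submodule.span_induction with
    | mem x hx =>
      intro c
      rw [hρ c x (hΛ x hx)]
      exact Submodule.smul_mem _ _ (Submodule.subset_span hx)
    | zero => intro c; simp
    | add x y _ _ hx hy =>
      intro c
      rw [smul_add, map_add]
      exact Submodule.add_mem _ (hx c) (hy c)
    | smul a x _ hx =>
      intro c
      rw [smul_smul]
      exact hx _
  have hu' : u ∈ Submodule.span ℚ (Λ : Set RInf) := by
    have h1 := key u h 1
    have h2 : r 1 = 1 := by simpa using hr' 1
    rwa [hρ 1 u hu, h2, one_smul] at h1
  clear h hu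
  induction hu' using Submodule.span_induction with
  | mem x hx => exact ⟨1, one_ne_zero, by simpa using hx⟩
  | zero => exact ⟨1, one_ne_zero, by simp⟩
  | add x y _ _ hx hy =>
    obtain ⟨m, hm, hm'⟩ := hx
    obtain ⟨n, hn, hn'⟩ := hy
    refine ⟨m * n, mul_ne_zero hm hn, ?_⟩
    rw [smul_add]
    refine Λ.add_mem ?_ ?_
    · rw [mul_comm, mul_smul]; exact Λ.smul_mem _ hm'
    · rw [mul_smul]; exact Λ.smul_mem _ hn'
  | smul q x _ hx =>
    obtain ⟨m, hm, hm'⟩ := hx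
    refine ⟨q.den * m, mul_ne_zero (by exact_mod_cast q.den_ne_zero) hm, ?_⟩
    have : ((q.den : ℤ) * m) • (q • x) = q.num • (m • x) := by
      rw [← Int.cast_smul_eq_zsmul ℚ, ← Int.cast_smul_eq_zsmul ℚ, ← Int.cast_smul_eq_zsmul ℚ,
        smul_smul, smul_smul]
      congr 1
      push_cast
      have := Rat.den_mul_eq_num q
      calc (q.den : ℚ) * m * q = ((q.den : ℚ) * q) * m := by ring
        _ = _ := by rw [this]
    rw [this]
    exact Λ.smul_mem _ hm'

/-! ### Orthogonal projections -/

/-- Gram-Schmidt: orthogonal projections to finitely generated subspaces exist, and are rational for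
rational data. -/
lemma RatInnerProduct.exists_orth (Q : RatInnerProduct) (s : Finset RInf) :
    ∀ u, ∃ w ∈ Submodule.span ℝ (s : Set RInf), (∀ f ∈ s, Q.form f (u - w) = 0) ∧
      ((∀ f ∈ s, IsRational f) → IsRational u → IsRational w) := by
  classical
  induction s using Finset.induction_on with
  | empty => exact fun u => ⟨0, Submodule.zero_mem _, by simp, fun _ _ => IsRational.zero⟩
  | insert f s _ ih =>
    intro u
    obtain ⟨w, hw, hw0, hwr⟩ := ih u
    obtain ⟨v, hv, hv0, hvr⟩ := ih f
    have hle : Submodule.span ℝ (s : Set RInf) ≤ Submodule.span ℝ ((insert f s : Finset _) : Set _) :=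
      Submodule.span_mono (by simp)
    have hfmem : f ∈ Submodule.span ℝ ((insert f s : Finset RInf) : Set RInf) :=
      Submodule.subset_span (by simp)
    have hspan : ∀ x, (∀ g ∈ s, Q.form g x = 0) → ∀ y ∈ Submodule.span ℝ (s : Set RInf),
        Q.form y x = 0 := by
      intro x hx y hy
      induction hy using Submodule.span_induction with
      | mem y hy => exact hx y hy
      | zero => simp
      | add a b _ _ ha hb => simp [ha, hb]
      | smul c a _ ha => simp [ha]
    by_cases hf : f - v = 0
    · refine ⟨w, hle hw, ?_, fun h hu => hwr (fun g hg => h g (Finset.mem_insert_of_mem hg)) hu⟩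
      intro g hg
      rcases Finset.mem_insert.1 hg with rfl | hg
      · rw [sub_eq_zero.1 hf]; exact hspan _ hw0 _ hv
      · exact hw0 g hg
    · have hpos := Q.pos _ hf
      refine ⟨w + (Q.form (f - v) (u - w) / Q.form (f - v) (f - v)) • (f - v), ?_, ?_, ?_⟩
      · exact Submodule.add_mem _ (hle hw)
          (Submodule.smul_mem _ _ (Submodule.sub_mem _ hfmem (hle hv)))
      · have hs : ∀ g ∈ s, Q.form g (u - (w + (Q.form (f - v) (u - w) /
            Q.form (f - v) (f - v)) • (f - v))) = 0 := by
          intro g hg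
          rw [← sub_sub, map_sub, hw0 g hg, map_smul, hv0 g hg]; simp
        intro g hg
        rcases Finset.mem_insert.1 hg with rfl | hg
        · have h1 := hspan _ hs _ hv
          have h2 : Q.form (g - v) (u - (w + (Q.form (g - v) (u - w) /
            Q.form (g - v) (g - v)) • (g - v))) = 0 := by
            rw [← sub_sub, map_sub _ (u - w), map_smul, smul_eq_mul, div_mul_cancel₀ _ hpos.ne',
              sub_self]
          generalize u - (w + (Q.form (g - v) (u - w) /
            Q.form (g - v) (g - v)) • (g - v)) = z at h1 h2 ⊢
          rwa [map_sub Q.form, LinearMap.sub_apply, h1, sub_zero] at h2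
        · exact hs g hg
      · intro h hu
        have hfr : IsRational (f - v) := (h f (Finset.mem_insert_self _ _)).sub
          (hvr (fun g hg => h g (Finset.mem_insert_of_mem hg)) (h f (Finset.mem_insert_self _ _)))
        have hwr' := hwr (fun g hg => h g (Finset.mem_insert_of_mem hg)) hu
        obtain ⟨p, hp⟩ := Q.rational_form hfr (hu.sub hwr')
        obtain ⟨q, hq⟩ := Q.rational_form hfr hfr
        rw [hp, hq, ← Rat.cast_div]
        exact hwr'.add (hfr.smul _)

lemma RatInnerProduct.orthogonal_span (Q : RatInnerProduct) (s : Set RInf) (x : RInf)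
    (hx : ∀ f ∈ s, Q.form f x = 0) : x ∈ Q.form.orthogonal (Submodule.span ℝ s) := by
  intro y hy
  induction hy using Submodule.span_induction with
  | mem y hy => exact hx y hy
  | zero => simp
  | add a b _ _ ha hb => simp [ha, hb]
  | smul c a _ ha => simp [ha]

lemma RatInnerProduct.isCompl (Q : RatInnerProduct) (W : Submodule ℝ RInf)
    [FiniteDimensional ℝ W] : IsCompl (Q.form.orthogonal W) W := by
  constructor
  · rw [Submodule.disjoint_def]
    intro x hx hxW
    by_contra hne
    exact (Q.pos x hne).ne' (hx x hxW)
  · rw [codisjoint_iff, Submodule.eq_top_iff']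
    intro u
    obtain ⟨s, rfl⟩ := (Submodule.fg_iff_finiteDimensional W).2 inferInstance
    obtain ⟨w, hw, hw0, -⟩ := Q.exists_orth s u
    rw [← sub_add_cancel u w]
    exact Submodule.add_mem_sup (Q.orthogonal_span _ _ hw0) hw

/-- The `Q`-orthogonal projection of `ℝ^∞` to the orthogonal subspace of `W`. -/
def RatInnerProduct.proj (Q : RatInnerProduct) (W : Submodule ℝ RInf)
    [FiniteDimensional ℝ W] : RInf →ₗ[ℝ] RInf :=
  (Q.form.orthogonal W).projection W (Q.isCompl W)

lemma RatInnerProduct.proj_eq_zero_iff (Q : RatInnerProduct) (W : Submodule ℝ RInf)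
    [FiniteDimensional ℝ W] (x : RInf) : Q.proj W x = 0 ↔ x ∈ W :=
  Submodule.projection_apply_eq_zero_iff _

lemma RatInnerProduct.proj_rational (Q : RatInnerProduct) (s : Finset RInf)
    (hs : ∀ f ∈ s, IsRational f) (W : Submodule ℝ RInf) [FiniteDimensional ℝ W]
    (hW : W = Submodule.span ℝ (s : Set RInf)) {u : RInf} (hu : IsRational u) :
    IsRational (Q.proj W u) := by
  subst hW
  obtain ⟨w, hw, hw0, hwr⟩ := Q.exists_orth s u
  have h1 : Q.proj (Submodule.span ℝ (s : Set RInf)) u = u - w := by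
    conv_lhs => rw [← sub_add_cancel u w, map_add, (Q.proj_eq_zero_iff _ w).2 hw, add_zero]
    exact Submodule.projection_apply_of_mem_left _ (Q.orthogonal_span _ _ hw0)
  rw [h1]
  exact hu.sub (hwr hs hu)

/-! ### Lattice cones: unit, orthogonality, product, faces, transverse cones -/

namespace LatticeCone

/-- The linear subspace spanned by (the cone of) a lattice cone. -/
def linSpan (C : LatticeCone) : Submodule ℝ RInf := Submodule.span ℝ (C.cone : Set RInf)

/-- The trivial lattice cone `({0}, {0})`. -/
def unit : LatticeCone where
  cone := ⊥
  lattice := ⊥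
  polyhedral := ⟨∅, by simp, by simp⟩
  salient := fun x hx _ => by simpa using hx
  lattice_rational := fun u hu => by
    rw [(Submodule.mem_bot ℤ).1 hu]; exact IsRational.zero
  lattice_fg := Submodule.fg_bot
  span_lattice := by simp

/-- Two lattice cones are orthogonal if their lattices are. -/
def Orth (Q : RatInnerProduct) (C D : LatticeCone) : Prop :=
  ∀ u ∈ C.lattice, ∀ v ∈ D.lattice, Q.form u v = 0

lemma Orth.span {Q : RatInnerProduct} {C D : LatticeCone} (h : Orth Q C D) {x y : RInf}
    (hx : x ∈ C.linSpan) (hy : y ∈ D.linSpan) : Q.form x y = 0 := by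
  rw [linSpan, ← C.span_lattice] at hx
  rw [linSpan, ← D.span_lattice] at hy
  refine Q.orthogonal_span _ y (fun f hf => ?_) x hx
  rw [Q.symm]
  exact Q.orthogonal_span _ f (fun g hg => by rw [Q.symm]; exact h f hf g hg) y hy

/-- The Minkowski product `(C + D, Λ_C + Λ_D)` of orthogonal lattice cones. -/
def mul (Q : RatInnerProduct) (C D : LatticeCone) (h : Orth Q C D) : LatticeCone where
  cone := C.cone ⊔ D.cone
  lattice := C.lattice ⊔ D.lattice
  polyhedral := by
    classical
    obtain ⟨s, hs, hs'⟩ := C.polyhedral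
    obtain ⟨t, ht, ht'⟩ := D.polyhedral
    refine ⟨s ∪ t, fun u hu => ?_, ?_⟩
    · rcases Finset.mem_union.1 hu with hu | hu
      exacts [hs u hu, ht u hu]
    · rw [hs', ht', Finset.coe_union]
      exact (Submodule.span_union _ _).symm
  salient := by
    intro x hx hx'
    obtain ⟨c, hc, d, hd, rfl⟩ := Submodule.mem_sup.1 hx
    obtain ⟨c', hc', d', hd', he⟩ := Submodule.mem_sup.1 hx'
    have h1 : c + c' = -(d + d') := by
      rw [eq_neg_iff_add_eq_zero, ← add_neg_cancel (c + d), ← he]; abel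
    have hC : c + c' ∈ C.linSpan := Submodule.subset_span (C.cone.add_mem hc hc')
    have hD : c + c' ∈ D.linSpan := by
      rw [h1]
      exact Submodule.neg_mem _ (Submodule.subset_span (D.cone.add_mem hd hd'))
    have h0 : c + c' = 0 := by
      by_contra hne
      exact (Q.pos _ hne).ne' (h.span hC hD)
    have h0' : d + d' = 0 := by rw [h0, eq_comm, neg_eq_zero] at h1; exact h1
    rw [C.salient c hc (by rwa [neg_eq_of_add_eq_zero_right h0]),
      D.salient d hd (by rwa [neg_eq_of_add_eq_zero_right h0']), add_zero]
  lattice_rational := by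
    intro u hu
    obtain ⟨a, ha, b, hb, rfl⟩ := Submodule.mem_sup.1 hu
    exact (C.lattice_rational a ha).add (D.lattice_rational b hb)
  lattice_fg := C.lattice_fg.sup D.lattice_fg
  span_lattice := by
    have key : ∀ {R : Type} [Semiring R] [Module R RInf] [Module R ℝ] [IsScalarTower R ℝ RInf]
        (A B : Submodule R RInf), Submodule.span ℝ ((A ⊔ B : Submodule R RInf) : Set RInf) =
        Submodule.span ℝ (A : Set RInf) ⊔ Submodule.span ℝ (B : Set RInf) := by
      intro R _ _ _ _ A B
      refine le_antisymm (Submodule.span_le.2 fun x hx => ?_)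
        (sup_le (Submodule.span_mono fun x hx => Submodule.mem_sup_left hx)
          (Submodule.span_mono fun x hx => Submodule.mem_sup_right hx))
      obtain ⟨a, ha, b, hb, rfl⟩ := Submodule.mem_sup.1 hx
      exact Submodule.add_mem_sup (Submodule.subset_span ha) (Submodule.subset_span hb)
    rw [key, key, C.span_lattice, D.span_lattice]

/-- The faces of (the cone of) a lattice cone. -/
def Face (C : LatticeCone) : Type := {F : PointedCone ℝ RInf // F.IsFaceOf C.cone}

/-- A face is generated by the generators of the cone that it contains. -/
lemma face_eq_hull (C : LatticeCone) (s : Finset RInf) (hs : C.cone = PointedCone.hull ℝ s)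
    (F : C.Face) : F.1 = PointedCone.hull ℝ {u | u ∈ s ∧ u ∈ F.1} := by
  classical
  refine le_antisymm (fun x hx => ?_) (Submodule.span_le.2 fun u hu => hu.2)
  have hxC : x ∈ PointedCone.hull ℝ (s : Set RInf) := hs ▸ F.2.le hx
  obtain ⟨f, -, rfl⟩ := Submodule.mem_span_finset.1 hxC
  refine Submodule.sum_mem _ fun u hu => ?_
  have hsC : ∀ v ∈ s, v ∈ C.cone := fun v hv => hs ▸ PointedCone.subset_hull hv
  rcases eq_or_ne (f u) 0 with h0 | h0
  · rw [h0, zero_smul]; exact Submodule.zero_mem _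
  · refine Submodule.smul_mem _ _ (Submodule.subset_span ⟨hu, ?_⟩)
    rw [← Finset.add_sum_erase s _ hu] at hx
    exact F.2.mem_of_smul_add_mem (hsC u hu) (Submodule.sum_mem _ fun v hv =>
      PointedCone.smul_mem _ (f v).2 (hsC v (Finset.mem_of_mem_erase hv)))
      (a := (f u : ℝ)) (lt_of_le_of_ne (f u).2 fun h => h0 (Subtype.ext h.symm)) hx

instance (C : LatticeCone) : Finite C.Face := by
  classical
  obtain ⟨s, -, hs⟩ := C.polyhedral
  refine Finite.of_injective (fun F : C.Face => (⟨s.filter (· ∈ F.1), by simp⟩ : s.powerset)) ?_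
  intro F G h
  have h' : s.filter (· ∈ F.1) = s.filter (· ∈ G.1) := congrArg Subtype.val h
  refine Subtype.ext ?_
  rw [C.face_eq_hull s hs F, C.face_eq_hull s hs G]
  congr 1
  ext u
  simpa using Finset.ext_iff.1 h' u

instance (C : LatticeCone) : Fintype C.Face := Fintype.ofFinite _

/-- A face `F` of a lattice cone `(C, Λ_C)`, as the lattice cone `(F, Λ_C ∩ lin F)`. -/
def face (C : LatticeCone) (F : C.Face) : LatticeCone where
  cone := F.1
  lattice := C.lattice ⊓ (Submodule.span ℝ (F.1 : Set RInf)).restrictScalars ℤ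
  polyhedral := by
    classical
    obtain ⟨s, hs, hs'⟩ := C.polyhedral
    refine ⟨s.filter (· ∈ F.1), fun u hu => hs u (Finset.mem_filter.1 hu).1, ?_⟩
    conv_lhs => rw [C.face_eq_hull s hs' F]
    congr 1
    ext u
    simp
  salient := fun x hx hx' => C.salient x (F.2.le hx) (F.2.le hx')
  lattice_rational := fun u hu => C.lattice_rational u hu.1
  lattice_fg := by
    have : IsNoetherian ℤ C.lattice := isNoetherian_of_fg_of_noetherian _ C.lattice_fg
    exact Submodule.FG.of_le C.lattice_fg inf_le_left
  span_lattice := by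
    refine le_antisymm (Submodule.span_le.2 fun x hx => hx.2) ?_
    obtain ⟨s, hs, hs'⟩ := C.polyhedral
    have h1 : (F.1 : Set RInf) ⊆ Submodule.span ℝ {u | u ∈ s ∧ u ∈ F.1} := by
      intro x hx
      have hx' : x ∈ F.1 := hx
      rw [C.face_eq_hull s hs' F] at hx'
      exact PointedCone.hull_le_span ℝ _ hx'
    refine (Submodule.span_le.2 h1).trans (Submodule.span_le.2 ?_)
    rintro u ⟨hus, huF⟩
    have huC : u ∈ Submodule.span ℝ (C.lattice : Set RInf) := by
      rw [C.span_lattice]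
      exact Submodule.subset_span (F.2.le huF)
    obtain ⟨n, hn, hnu⟩ := exists_smul_mem_of_mem_span C.lattice C.lattice_rational (hs u hus) huC
    have h2 : n • u ∈ C.lattice ⊓ (Submodule.span ℝ (F.1 : Set RInf)).restrictScalars ℤ :=
      ⟨hnu, Submodule.smul_mem _ n (Submodule.subset_span huF)⟩
    have h3 : u = (n : ℝ)⁻¹ • (n • u) := by
      rw [← Int.cast_smul_eq_zsmul ℝ, smul_smul, inv_mul_cancel₀ (by exact_mod_cast hn), one_smul]
    rw [h3]
    exact Submodule.smul_mem _ _ (Submodule.subset_span h2)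

lemma linSpan_eq (C : LatticeCone) (s : Finset RInf) (hs : C.cone = PointedCone.hull ℝ s) :
    C.linSpan = Submodule.span ℝ (s : Set RInf) := by
  refine le_antisymm (Submodule.span_le.2 fun x hx => ?_) (Submodule.span_mono ?_)
  · have hx' : x ∈ C.cone := hx
    rw [hs] at hx'
    exact PointedCone.hull_le_span ℝ _ hx'
  · rw [hs]
    exact PointedCone.subset_hull

instance (C : LatticeCone) : FiniteDimensional ℝ C.linSpan := by
  obtain ⟨s, -, hs⟩ := C.polyhedral
  rw [C.linSpan_eq s hs]
  exact FiniteDimensional.span_finset ℝ s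

/-- The transverse cone `t((C, Λ_C), (F, Λ_F))`: the orthogonal projection of `(C, Λ_C)` to the
orthogonal subspace of the linear span of `F`. -/
def transverse (Q : RatInnerProduct) (C : LatticeCone) (F : C.Face) : LatticeCone where
  cone := C.cone.map (Q.proj (C.face F).linSpan)
  lattice := C.lattice.map ((Q.proj (C.face F).linSpan).restrictScalars ℤ)
  polyhedral := by
    classical
    obtain ⟨s, hs, hs'⟩ := C.polyhedral
    obtain ⟨t, ht, ht'⟩ := (C.face F).polyhedral
    refine ⟨s.image (Q.proj (C.face F).linSpan), fun u hu => ?_, ?_⟩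
    · obtain ⟨v, hv, rfl⟩ := Finset.mem_image.1 hu
      exact Q.proj_rational t ht _ ((C.face F).linSpan_eq t ht') (hs v hv)
    · rw [hs', Finset.coe_image]
      exact Submodule.map_span _ _
  salient := by
    intro x hx hx'
    obtain ⟨c, hc, rfl⟩ := PointedCone.mem_map.1 hx
    obtain ⟨c', hc', he⟩ := PointedCone.mem_map.1 hx'
    have h1 : c + c' ∈ (C.face F).linSpan := by
      rw [← Q.proj_eq_zero_iff, map_add, he, add_neg_cancel]
    have h2 : ∀ y ∈ (C.face F).linSpan, ∃ f ∈ F.1, ∃ f' ∈ F.1, y + f' = f := by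
      intro y hy
      induction hy using Submodule.span_induction with
      | mem y hy => exact ⟨y, hy, 0, F.1.zero_mem, add_zero y⟩
      | zero => exact ⟨0, F.1.zero_mem, 0, F.1.zero_mem, add_zero 0⟩
      | add a b _ _ ha hb =>
        obtain ⟨f, hf, f', hf', e⟩ := ha
        obtain ⟨g, hg, g', hg', e'⟩ := hb
        exact ⟨f + g, F.1.add_mem hf hg, f' + g', F.1.add_mem hf' hg', by rw [← e, ← e']; abel⟩
      | smul r a _ ha =>
        obtain ⟨f, hf, f', hf', e⟩ := ha
        rcases le_total 0 r with hr | hr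
        · exact ⟨r • f, PointedCone.smul_mem _ hr hf, r • f', PointedCone.smul_mem _ hr hf',
            by rw [← e, smul_add]⟩
        · refine ⟨(-r) • f', PointedCone.smul_mem _ (neg_nonneg.2 hr) hf',
            (-r) • f, PointedCone.smul_mem _ (neg_nonneg.2 hr) hf, ?_⟩
          rw [← e]; module
    obtain ⟨f, hf, f', hf', e⟩ := h2 _ h1
    have hcF : c ∈ F.1 := F.2.mem_of_smul_add_mem (a := (1 : ℝ)) hc
      (C.cone.add_mem hc' (F.2.le hf')) one_pos (by rw [one_smul, ← add_assoc, e]; exact hf)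
    exact (Q.proj_eq_zero_iff _ c).2 (Submodule.subset_span hcF)
  lattice_rational := by
    intro u hu
    obtain ⟨t, ht, ht'⟩ := (C.face F).polyhedral
    obtain ⟨v, hv, rfl⟩ := Submodule.mem_map.1 hu
    exact Q.proj_rational t ht _ ((C.face F).linSpan_eq t ht') (C.lattice_rational v hv)
  lattice_fg := C.lattice_fg.map _
  span_lattice := by
    have h := congrArg (Submodule.map (Q.proj (C.face F).linSpan)) C.span_lattice
    rw [Submodule.map_span, Submodule.map_span] at h
    exact h

end LatticeCone

/-! ### The space of lattice cones and its structure maps -/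

/-- `ℚ𝒞`: the vector space over `ℚ` spanned by the set of lattice cones. -/
abbrev ConeSpace : Type := LatticeCone →₀ ℚ

/-- The locality relation on `ℚ𝒞`, extended linearly from orthogonality of lattice cones. -/
def coneTop (Q : RatInnerProduct) : ConeSpace → ConeSpace → Prop :=
  freeTop (LatticeCone.Orth Q)

open Classical in
/-- The bilinear map on `ℚ𝒞` that is the Minkowski product on orthogonal pairs of lattice cones
(and zero on other pairs, which do not occur in related elements of `ℚ𝒞`). -/
def mulAux (Q : RatInnerProduct) : ConeSpace →ₗ[ℚ] ConeSpace →ₗ[ℚ] ConeSpace :=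
  Finsupp.linearCombination ℚ fun C => Finsupp.linearCombination ℚ fun D =>
    if h : LatticeCone.Orth Q C D then Finsupp.single (LatticeCone.mul Q C D h) 1 else 0

/-- The Minkowski product on related pairs of `ℚ𝒞`. -/
def coneMul (Q : RatInnerProduct) (x y : ConeSpace) (_ : coneTop Q x y) : ConeSpace :=
  mulAux Q x y

/-- The unit of `ℚ𝒞`: the trivial lattice cone. -/
def coneOne : ConeSpace := Finsupp.single LatticeCone.unit 1

/-- The transverse coproduct `Δ(C) = ∑_F t(C, F) ⊗ F`, the sum over all faces `F` of `C`. -/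
def coneComul (Q : RatInnerProduct) : ConeSpace →ₗ[ℚ] ConeSpace ⊗[ℚ] ConeSpace :=
  Finsupp.linearCombination ℚ fun C => ∑ F : C.Face,
    Finsupp.single (LatticeCone.transverse Q C F) (1 : ℚ) ⊗ₜ[ℚ] Finsupp.single (C.face F) (1 : ℚ)

open Classical in
/-- The counit: `1` on the trivial lattice cone and `0` on all other lattice cones. -/
def coneCounit : ConeSpace →ₗ[ℚ] ℚ :=
  Finsupp.linearCombination ℚ fun C => if C = LatticeCone.unit then 1 else 0

end

end LocalityCone

namespace LocalityCone

noncomputable section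

/-! ### Orthogonal projections -/

namespace RatInnerProduct

variable (Q : RatInnerProduct)

/-! The content is the combinatorics of faces; the rest is formal. Orthogonality of lattice cones
depends only on their linear spans (`orth_iff`), and the spans of a face `F` and of `t(C, F)` both
lie in `lin C`. Hence everything orthogonal to `C` stays orthogonal to all terms of `Δ(C)`, which
gives the locality conditions.

Coassociativity: both iterated coproducts of `C` equal the sum of `t(C, F') ⊗ t(F', F) ⊗ F` over
flags `F ≤ F'` of faces. Faces of `F'` are the faces of `C` below `F'` (`faceFaceEquiv`), faces of
`t(C, F)` are the projections of the faces above `F` (`faceTransverseEquiv`), and projecting along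
`F` and then along the image of `F'` amounts to projecting along `F'` (`proj_comp_proj`).

Multiplicativity: for orthogonal `C` and `D` the faces of `C + D` are the sums `F + G`
(`faceMulEquiv`), and their lattices and transverse cones split accordingly.

Antipode: extended by zero to all pairs of lattice cones, the product remains bilinear, commutative
and associative (`mulAux_assoc`), so convolution is an ordinary associative product with unit `u ∘
ε`. A left inverse of the identity is obtained by recursion on `dim lin C`, because `t(C, F)` has
smaller dimension for `F ≠ 0`. It is also a right inverse, since left convolution by it is injective
(`eq_zero_of_antipode_conv_eq_zero`). The recursion never leaves `lin C`, which yields independence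
from the identity. -/

lemma proj_eq (W : Submodule ℝ RInf) [FiniteDimensional ℝ W] {x y : RInf}
    (hy : ∀ w ∈ W, Q.form w y = 0) (hxy : x - y ∈ W) : Q.proj W x = y := by
  rw [← sub_add_cancel x y, map_add, (Q.proj_eq_zero_iff W _).2 hxy, zero_add]
  exact Submodule.projection_apply_of_mem_left _ hy

lemma form_proj (W : Submodule ℝ RInf) [FiniteDimensional ℝ W] {w : RInf} (hw : w ∈ W)
    (x : RInf) : Q.form w (Q.proj W x) = 0 :=
  (Submodule.projection_apply_mem (Q.isCompl W) x : Q.proj W x ∈ Q.form.orthogonal W) w hw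

lemma sub_proj_mem (W : Submodule ℝ RInf) [FiniteDimensional ℝ W] (x : RInf) :
    x - Q.proj W x ∈ W := by
  rw [← Q.proj_eq_zero_iff W, map_sub, sub_eq_zero]
  exact (Q.proj_eq W (fun w hw => Q.form_proj W hw x) (by simp)).symm

lemma proj_eq_iff_sub_mem (W : Submodule ℝ RInf) [FiniteDimensional ℝ W] {x y : RInf} :
    Q.proj W x = Q.proj W y ↔ x - y ∈ W := by
  rw [← Q.proj_eq_zero_iff W, map_sub, sub_eq_zero]

lemma proj_congr {W W' : Submodule ℝ RInf} [FiniteDimensional ℝ W] [FiniteDimensional ℝ W']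
    (h : W = W') : Q.proj W = Q.proj W' := by
  subst h; rfl

lemma proj_bot [FiniteDimensional ℝ (⊥ : Submodule ℝ RInf)] : Q.proj ⊥ = LinearMap.id :=
  LinearMap.ext fun _ => Q.proj_eq _ (by simp) (by simp)

/-- Projecting along `W`, then along the image of `V ≥ W`, is projecting along `V`. -/
lemma proj_comp_proj {W V U : Submodule ℝ RInf} [FiniteDimensional ℝ W] [FiniteDimensional ℝ V]
    [FiniteDimensional ℝ U] (hWV : W ≤ V) (hU : U = V.map (Q.proj W)) :
    Q.proj U ∘ₗ Q.proj W = Q.proj V := by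
  subst hU
  refine LinearMap.ext fun x => (Q.proj_eq V (fun v hv => ?_) ?_).symm
  -- Split `v` into its part in `W` and its projection. The first is orthogonal to the doubly
  -- projected vector, a difference of two vectors orthogonal to `W`; the second lies in the
  -- subspace along which the second projection is taken.
  · have h1 : Q.form (v - Q.proj W v) (Q.proj (V.map (Q.proj W)) (Q.proj W x)) = 0 := by
      have hw := Q.sub_proj_mem W v
      obtain ⟨v', hv', he⟩ := Submodule.mem_map.1
        (Q.sub_proj_mem (V.map (Q.proj W)) (Q.proj W x))
      rw [← sub_sub_cancel (Q.proj W x) (Q.proj (V.map (Q.proj W)) (Q.proj W x)), ← he, map_sub,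
        Q.form_proj W hw, Q.form_proj W hw, sub_zero]
    have h2 := Q.form_proj (V.map (Q.proj W)) (Submodule.mem_map_of_mem hv) (Q.proj W x)
    rw [← sub_add_cancel v (Q.proj W v), map_add, LinearMap.add_apply, LinearMap.comp_apply, h1, h2,
      add_zero]
  · rw [← sub_add_sub_cancel x (Q.proj W x)]
    refine V.add_mem (hWV (Q.sub_proj_mem W x)) ?_
    obtain ⟨v', hv', he⟩ := Submodule.mem_map.1
      (Q.sub_proj_mem (V.map (Q.proj W)) (Q.proj W x))
    rw [LinearMap.comp_apply, ← he, ← sub_sub_cancel v' (Q.proj W v')]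
    exact V.sub_mem hv' (hWV (Q.sub_proj_mem W v'))

lemma proj_mem {W V : Submodule ℝ RInf} [FiniteDimensional ℝ W] (h : W ≤ V) {x : RInf}
    (hx : x ∈ V) : Q.proj W x ∈ V := by
  rw [← sub_sub_cancel x (Q.proj W x)]
  exact V.sub_mem hx (h (Q.sub_proj_mem W x))

/-- On a vector orthogonal to `V`, projecting along `W ⊔ V` is projecting along `W`. -/
lemma proj_sup {W V U : Submodule ℝ RInf} [FiniteDimensional ℝ W] [FiniteDimensional ℝ V]
    [FiniteDimensional ℝ U] (hU : U = W ⊔ V) (hWV : ∀ w ∈ W, ∀ v ∈ V, Q.form w v = 0)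
    {x : RInf} (hx : ∀ v ∈ V, Q.form x v = 0) : Q.proj U x = Q.proj W x := by
  subst hU
  refine Q.proj_eq _ (fun u hu => ?_) (Submodule.mem_sup_left (Q.sub_proj_mem W x))
  obtain ⟨w, hw, v, hv, rfl⟩ := Submodule.mem_sup.1 hu
  -- The projection of `x` is `x` minus a vector of `W`, and both are orthogonal to `V`.
  rw [map_add, LinearMap.add_apply, Q.form_proj W hw, zero_add,
    ← sub_sub_cancel x (Q.proj W x), map_sub, Q.symm v x, hx v hv,
    Q.symm v, hWV _ (Q.sub_proj_mem W x) v hv, sub_zero]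

end RatInnerProduct

/-! ### Lattice cones -/

/-- Differences of elements of a cone are closed under negative scalars, as these swap the two
terms; hence they fill the linear span. -/
lemma _root_.PointedCone.exists_sub_of_mem_span {F : PointedCone ℝ RInf} {y : RInf}
    (hy : y ∈ Submodule.span ℝ (F : Set RInf)) : ∃ f ∈ F, ∃ f' ∈ F, y + f' = f := by
  induction hy using Submodule.span_induction with
  | mem y hy => exact ⟨y, hy, 0, F.zero_mem, add_zero y⟩
  | zero => exact ⟨0, F.zero_mem, 0, F.zero_mem, add_zero 0⟩
  | add a b _ _ ha hb =>
    obtain ⟨f, hf, f', hf', e⟩ := ha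
    obtain ⟨g, hg, g', hg', e'⟩ := hb
    exact ⟨f + g, F.add_mem hf hg, f' + g', F.add_mem hf' hg', by rw [← e, ← e']; abel⟩
  | smul r a _ ha =>
    obtain ⟨f, hf, f', hf', e⟩ := ha
    rcases le_total 0 r with hr | hr
    · exact ⟨r • f, PointedCone.smul_mem _ hr hf, r • f', PointedCone.smul_mem _ hr hf',
        by rw [← e, smul_add]⟩
    · refine ⟨(-r) • f', PointedCone.smul_mem _ (neg_nonneg.2 hr) hf',
        (-r) • f, PointedCone.smul_mem _ (neg_nonneg.2 hr) hf, ?_⟩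
      rw [← e]; module

lemma _root_.PointedCone.span_map (f : RInf →ₗ[ℝ] RInf) (C : PointedCone ℝ RInf) :
    Submodule.span ℝ (C.map f : Set RInf) = (Submodule.span ℝ (C : Set RInf)).map f := by
  rw [PointedCone.coe_map, Submodule.map_span]

/-- A point of the cone that differs from a point of the face `F'` by an element of the span of a
subcone of `F'` lies in `F'`. -/
lemma _root_.PointedCone.IsFaceOf.mem_of_sub_mem_span {C F F' : PointedCone ℝ RInf}
    (hF' : F'.IsFaceOf C) (h : F ≤ F') {x y : RInf} (hx : x ∈ C) (hy : y ∈ F')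
    (hxy : x - y ∈ Submodule.span ℝ (F : Set RInf)) : x ∈ F' := by
  -- With `x - y = f - f'`, the sum `x + f' = y + f` lies in `F'` and both summands on the left lie
  -- in `C`, so the face property applies to `x`.
  obtain ⟨f, hf, f', hf', e⟩ := PointedCone.exists_sub_of_mem_span hxy
  refine hF'.mem_of_add_mem_left hx (hF'.le (h hf')) ?_
  have : x + f' = y + f := by rw [← e]; abel
  rw [this]
  exact F'.add_mem hy (h hf)

namespace LatticeCone

lemma lattice_le_linSpan (C : LatticeCone) {u : RInf} (hu : u ∈ C.lattice) : u ∈ C.linSpan := by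
  rw [linSpan, ← C.span_lattice]; exact Submodule.subset_span hu

lemma cone_le_linSpan (C : LatticeCone) {u : RInf} (hu : u ∈ C.cone) : u ∈ C.linSpan :=
  Submodule.subset_span hu

lemma eq_unit_of_linSpan_eq_bot (C : LatticeCone) (h : C.linSpan = ⊥) : C = unit := by
  refine LatticeCone.ext ?_ ?_
  · exact (Submodule.eq_bot_iff _).2 fun x hx => by
      simpa [h] using C.cone_le_linSpan hx
  · exact (Submodule.eq_bot_iff _).2 fun x hx => by
      simpa [h] using C.lattice_le_linSpan hx

lemma linSpan_unit : unit.linSpan = ⊥ := by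
  simp [linSpan, unit]

/-- Reduces triviality of a lattice cone to its linear span, which is easy to compute for products,
faces and projections. -/
lemma linSpan_eq_bot_iff (C : LatticeCone) : C.linSpan = ⊥ ↔ C = unit :=
  ⟨C.eq_unit_of_linSpan_eq_bot, fun h => h ▸ linSpan_unit⟩

lemma linSpan_mul {Q : RatInnerProduct} {C D : LatticeCone} (h : Orth Q C D) :
    (mul Q C D h).linSpan = C.linSpan ⊔ D.linSpan := by
  refine le_antisymm (Submodule.span_le.2 fun x hx => ?_)
    (sup_le (Submodule.span_mono fun x hx => Submodule.mem_sup_left hx)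
      (Submodule.span_mono fun x hx => Submodule.mem_sup_right hx))
  obtain ⟨a, ha, b, hb, rfl⟩ := Submodule.mem_sup.1 (show x ∈ C.cone ⊔ D.cone from hx)
  exact Submodule.add_mem_sup (Submodule.subset_span ha) (Submodule.subset_span hb)

lemma linSpan_face_le (C : LatticeCone) (F : C.Face) : (C.face F).linSpan ≤ C.linSpan :=
  Submodule.span_mono F.2.le

lemma linSpan_transverse (Q : RatInnerProduct) (C : LatticeCone) (F : C.Face) :
    (transverse Q C F).linSpan = C.linSpan.map (Q.proj (C.face F).linSpan) :=
  PointedCone.span_map _ _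

lemma linSpan_transverse_le (Q : RatInnerProduct) (C : LatticeCone) (F : C.Face) :
    (transverse Q C F).linSpan ≤ C.linSpan := by
  rw [linSpan_transverse]
  rintro _ ⟨x, hx, rfl⟩
  exact Q.proj_mem (C.linSpan_face_le F) hx

/-- The lattice and the cone span the same real subspace and the form is bilinear. Orthogonality
therefore passes to any lattice cones with smaller spans (`Orth.mono`). -/
lemma orth_iff {Q : RatInnerProduct} {C D : LatticeCone} :
    Orth Q C D ↔ ∀ x ∈ C.linSpan, ∀ y ∈ D.linSpan, Q.form x y = 0 :=
  ⟨fun h _ hx _ hy => h.span hx hy,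
    fun h u hu v hv => h u (C.lattice_le_linSpan hu) v (D.lattice_le_linSpan hv)⟩

lemma Orth.symm {Q : RatInnerProduct} {C D : LatticeCone} (h : Orth Q C D) : Orth Q D C :=
  fun u hu v hv => by rw [Q.symm]; exact h v hv u hu

lemma orth_comm {Q : RatInnerProduct} {C D : LatticeCone} : Orth Q C D ↔ Orth Q D C :=
  ⟨Orth.symm, Orth.symm⟩

lemma Orth.mono {Q : RatInnerProduct} {C D C' D' : LatticeCone} (h : Orth Q C D)
    (hC : C'.linSpan ≤ C.linSpan) (hD : D'.linSpan ≤ D.linSpan) : Orth Q C' D' :=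
  orth_iff.2 fun _ hx _ hy => h.span (hC hx) (hD hy)

lemma orth_unit_left (Q : RatInnerProduct) (C : LatticeCone) : Orth Q unit C := fun u hu v _ => by
  rw [(Submodule.mem_bot ℤ).1 hu]; simp

lemma orth_unit_right (Q : RatInnerProduct) (C : LatticeCone) : Orth Q C unit :=
  (orth_unit_left Q C).symm

lemma orth_transverse_face (Q : RatInnerProduct) (C : LatticeCone) (F : C.Face) :
    Orth Q (transverse Q C F) (C.face F) := by
  rw [orth_iff, linSpan_transverse]
  rintro _ ⟨x, _, rfl⟩ y hy
  rw [Q.symm]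
  exact Q.form_proj _ hy x

lemma orth_mul_left {Q : RatInnerProduct} {C D E : LatticeCone} (h : Orth Q C D) :
    Orth Q (mul Q C D h) E ↔ Orth Q C E ∧ Orth Q D E := by
  refine ⟨fun H => ⟨fun u hu => H u (Submodule.mem_sup_left hu),
    fun u hu => H u (Submodule.mem_sup_right hu)⟩, fun ⟨h1, h2⟩ u hu v hv => ?_⟩
  obtain ⟨a, ha, b, hb, rfl⟩ := Submodule.mem_sup.1 (show u ∈ C.lattice ⊔ D.lattice from hu)
  rw [map_add, LinearMap.add_apply, h1 a ha v hv, h2 b hb v hv, add_zero]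

lemma orth_mul_right {Q : RatInnerProduct} {C D E : LatticeCone} (h : Orth Q C D) :
    Orth Q E (mul Q C D h) ↔ Orth Q E C ∧ Orth Q E D := by
  rw [orth_comm, orth_mul_left, orth_comm (C := C), orth_comm (C := D)]

lemma mul_comm' {Q : RatInnerProduct} {C D : LatticeCone} (h : Orth Q C D) :
    mul Q C D h = mul Q D C h.symm :=
  LatticeCone.ext (sup_comm _ _) (sup_comm _ _)

lemma mul_assoc' {Q : RatInnerProduct} {C D E : LatticeCone} (h : Orth Q C D)
    (h₁ : Orth Q (mul Q C D h) E) (h' : Orth Q D E) (h₂ : Orth Q C (mul Q D E h')) :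
    mul Q (mul Q C D h) E h₁ = mul Q C (mul Q D E h') h₂ :=
  LatticeCone.ext (sup_assoc _ _ _) (sup_assoc _ _ _)

lemma mul_unit {Q : RatInnerProduct} {C : LatticeCone} (h : Orth Q C unit) :
    mul Q C unit h = C :=
  LatticeCone.ext (sup_bot_eq _) (sup_bot_eq _)

lemma mul_eq_unit_iff {Q : RatInnerProduct} {C D : LatticeCone} (h : Orth Q C D) :
    mul Q C D h = unit ↔ C = unit ∧ D = unit := by
  rw [← linSpan_eq_bot_iff, linSpan_mul, sup_eq_bot_iff, linSpan_eq_bot_iff, linSpan_eq_bot_iff]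

/-! ### Faces and transverse cones -/

instance (C : LatticeCone) : Top C.Face := ⟨⟨C.cone, .refl _⟩⟩

/-- Strong convexity is exactly what makes `{0}` a face. -/
instance (C : LatticeCone) : Bot C.Face :=
  ⟨⟨⊥, by
    refine ⟨bot_le, fun {x y a} hx hy ha h => ?_⟩
    have h' : a • x + y = 0 := h
    refine C.salient x hx ((PointedCone.smul_mem_iff _ ha).1 ?_)
    rw [smul_neg, neg_eq_of_add_eq_zero_right h']
    exact hy⟩⟩

lemma Face.ext_val {C : LatticeCone} {F G : C.Face} (h : F.1 = G.1) : F = G := Subtype.ext h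

lemma face_top (C : LatticeCone) : C.face ⊤ = C :=
  LatticeCone.ext rfl (inf_eq_left.2 fun _ hu => C.lattice_le_linSpan hu)

/-- A face is recovered from its span, as `C ∩ lin F = F`; so proper faces have strictly smaller
dimension. -/
lemma linSpan_face_eq_top_iff (C : LatticeCone) (F : C.Face) :
    (C.face F).linSpan = C.linSpan ↔ F = ⊤ := by
  refine ⟨fun h => Face.ext_val (le_antisymm F.2.le fun x hx => ?_), ?_⟩
  · refine F.2.mem_of_sub_mem_span le_rfl hx F.1.zero_mem ?_
    rw [sub_zero]
    exact h.symm.le (C.cone_le_linSpan hx)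
  · rintro rfl
    rw [face_top]

lemma face_eq_unit_iff (C : LatticeCone) (F : C.Face) : C.face F = unit ↔ F = ⊥ := by
  refine ⟨fun h => Face.ext_val (congrArg cone h), ?_⟩
  rintro rfl
  rw [← linSpan_eq_bot_iff]
  exact linSpan_unit

lemma face_bot (C : LatticeCone) : C.face ⊥ = unit := (C.face_eq_unit_iff _).2 rfl

/-- The projection kills `C` exactly when `lin C` is contained in `lin F`. -/
lemma transverse_eq_unit_iff (Q : RatInnerProduct) (C : LatticeCone) (F : C.Face) :
    transverse Q C F = unit ↔ F = ⊤ := by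
  rw [← linSpan_eq_bot_iff, linSpan_transverse, ← linSpan_face_eq_top_iff, eq_bot_iff,
    Submodule.map_le_iff_le_comap]
  refine ⟨fun h => le_antisymm (C.linSpan_face_le F) fun x hx => ?_, fun h x hx => ?_⟩
  · exact (Q.proj_eq_zero_iff _ x).1 (h hx)
  · exact (Q.proj_eq_zero_iff _ x).2 (h ▸ hx)

lemma transverse_top (Q : RatInnerProduct) (C : LatticeCone) : transverse Q C ⊤ = unit :=
  (transverse_eq_unit_iff Q C _).2 rfl

lemma transverse_bot (Q : RatInnerProduct) (C : LatticeCone) : transverse Q C ⊥ = C := by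
  have h : Q.proj (C.face ⊥).linSpan = LinearMap.id := by
    rw [Q.proj_congr (W' := ⊥) (by rw [face_bot, linSpan_unit]), Q.proj_bot]
  refine LatticeCone.ext ?_ ?_
  · change C.cone.map (Q.proj (C.face ⊥).linSpan) = C.cone
    rw [h, PointedCone.map_id]
  · change C.lattice.map ((Q.proj (C.face ⊥).linSpan).restrictScalars ℤ) = C.lattice
    rw [h]
    exact Submodule.map_id _

/-- If the dimension did not drop, `lin t(C, F)` would be all of `lin C` and so contain `lin F`, to
which it is orthogonal; this forces `F = 0`. The inequality makes the recursion for the antipode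
terminate. -/
lemma finrank_transverse_lt (Q : RatInnerProduct) (C : LatticeCone) (F : C.Face) (hF : F ≠ ⊥) :
    Module.finrank ℝ (transverse Q C F).linSpan < Module.finrank ℝ C.linSpan := by
  refine Submodule.finrank_lt_finrank_of_lt
    (lt_of_le_of_ne (linSpan_transverse_le Q C F) fun h => hF ?_)
  rw [← face_eq_unit_iff, ← linSpan_eq_bot_iff, Submodule.eq_bot_iff]
  intro x hx
  by_contra hne
  refine (Q.pos x hne).ne' ((orth_transverse_face Q C F).span ?_ hx)
  rw [h]
  exact C.linSpan_face_le F hx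

lemma finrank_face_lt (C : LatticeCone) (F : C.Face) (hF : F ≠ ⊤) :
    Module.finrank ℝ (C.face F).linSpan < Module.finrank ℝ C.linSpan :=
  Submodule.finrank_lt_finrank_of_lt
    (lt_of_le_of_ne (C.linSpan_face_le F) fun h => hF ((C.linSpan_face_eq_top_iff F).1 h))

/-- The faces of a face `F'` of `C` are the faces of `C` contained in `F'`. -/
def faceFaceEquiv (C : LatticeCone) (F' : C.Face) :
    {F : C.Face // F.1 ≤ F'.1} ≃ (C.face F').Face where
  toFun F := ⟨F.1.1, (F.1.2.isFaceOf_iff_le F'.2).2 F.2⟩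
  invFun G := ⟨⟨G.1, G.2.trans F'.2⟩, G.2.le⟩
  left_inv _ := rfl
  right_inv _ := rfl

/-- Cutting the lattice by `lin F'` first changes nothing, since `lin F` is contained in `lin F'`.
-/
lemma face_faceFaceEquiv (C : LatticeCone) (F' : C.Face) (F : {F : C.Face // F.1 ≤ F'.1}) :
    (C.face F').face (C.faceFaceEquiv F' F) = C.face F.1 := by
  refine LatticeCone.ext rfl (Submodule.ext fun x => ?_)
  change (x ∈ C.lattice ∧ x ∈ Submodule.span ℝ (F'.1 : Set RInf)) ∧
    x ∈ Submodule.span ℝ (F.1.1 : Set RInf) ↔ x ∈ C.lattice ∧ x ∈ Submodule.span ℝ (F.1.1 : Set RInf)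
  have h : x ∈ Submodule.span ℝ (F.1.1 : Set RInf) → x ∈ Submodule.span ℝ (F'.1 : Set RInf) :=
    fun hx => Submodule.span_mono F.2 hx
  tauto

/-- The faces of the transverse cone `t(C, F)` are the projections of the faces of `C` that
contain `F`. -/
def faceTransverseEquiv (Q : RatInnerProduct) (C : LatticeCone) (F : C.Face) :
    {F' : C.Face // F.1 ≤ F'.1} ≃ (transverse Q C F).Face where
  toFun F' := ⟨F'.1.1.map (Q.proj (C.face F).linSpan), by
    refine ⟨Submodule.map_mono F'.1.2.le, ?_⟩
    rintro _ _ a ⟨x, hx, rfl⟩ ⟨y, hy, rfl⟩ ha ⟨z, hz, h⟩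
    refine ⟨x, F'.1.2.mem_of_smul_add_mem hx hy ha ?_, rfl⟩
    -- The combination `a • x + y` has the same projection as a point `z` of `F'`, so it differs
    -- from `z` by an element of `lin F`; as `F ≤ F'`, it lies in `F'` itself.
    refine F'.1.2.mem_of_sub_mem_span F'.2
      (C.cone.add_mem (PointedCone.smul_mem _ ha.le hx) hy) hz ?_
    refine (Q.proj_eq_iff_sub_mem (C.face F).linSpan).1 ?_
    rw [map_add, map_smul]
    exact h.symm⟩
  -- The preimage has to be cut down to `C`; it contains `F` because `F` projects to `0`.
  invFun G := ⟨⟨G.1.comap (Q.proj (C.face F).linSpan) ⊓ C.cone, by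
      have h := (G.2.comap (Q.proj (C.face F).linSpan)).inf (PointedCone.IsFaceOf.refl C.cone)
      have hle : C.cone ≤ (transverse Q C F).cone.comap (Q.proj (C.face F).linSpan) :=
        fun x hx => ⟨x, hx, rfl⟩
      rwa [inf_eq_right.2 hle] at h⟩,
    fun x hx => ⟨by
      have h : Q.proj (C.face F).linSpan x = 0 :=
        (Q.proj_eq_zero_iff _ x).2 (Submodule.subset_span hx)
      exact (PointedCone.mem_comap).2 (h ▸ G.1.zero_mem), F.2.le hx⟩⟩
  left_inv F' := by
    refine Subtype.ext (Face.ext_val (le_antisymm ?_ fun x hx => ⟨⟨x, hx, rfl⟩, F'.1.2.le hx⟩))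
    rintro x ⟨⟨y, hy, h⟩, hx⟩
    exact F'.1.2.mem_of_sub_mem_span F'.2 hx hy
      ((Q.proj_eq_iff_sub_mem (C.face F).linSpan).1 h.symm)
  right_inv G := by
    refine Face.ext_val (le_antisymm ?_ fun x hx => ?_)
    · rintro _ ⟨x, hx, rfl⟩
      exact hx.1
    · obtain ⟨y, hy, rfl⟩ := G.2.le hx
      exact ⟨y, ⟨hx, hy⟩, rfl⟩

lemma linSpan_face_faceTransverseEquiv (Q : RatInnerProduct) (C : LatticeCone) (F : C.Face)
    (F' : {F' : C.Face // F.1 ≤ F'.1}) :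
    ((transverse Q C F).face (faceTransverseEquiv Q C F F')).linSpan =
      (C.face F'.1).linSpan.map (Q.proj (C.face F).linSpan) :=
  PointedCone.span_map _ _

/-- Transitivity of transverse cones: the two successive projections compose to the projection along
`lin F'`. -/
lemma transverse_faceTransverseEquiv (Q : RatInnerProduct) (C : LatticeCone) (F : C.Face)
    (F' : {F' : C.Face // F.1 ≤ F'.1}) :
    transverse Q (transverse Q C F) (faceTransverseEquiv Q C F F') = transverse Q C F'.1 := by
  have h := Q.proj_comp_proj (W := (C.face F).linSpan) (V := (C.face F'.1).linSpan)
    (Submodule.span_mono F'.2) (linSpan_face_faceTransverseEquiv Q C F F')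
  refine LatticeCone.ext ?_ ?_
  · refine (PointedCone.map_map _ _ _).trans ?_
    rw [h]; rfl
  · refine (Submodule.map_comp _ _ _).symm.trans ?_
    exact congrArg (fun f : RInf →ₗ[ℝ] RInf => C.lattice.map (f.restrictScalars ℤ)) h

/-- The cones agree at once. For the lattices, projecting commutes with intersecting with `lin F'`
because the kernel `lin F` is contained in `lin F'`. -/
lemma face_faceTransverseEquiv (Q : RatInnerProduct) (C : LatticeCone) (F : C.Face)
    (F' : {F' : C.Face // F.1 ≤ F'.1}) :
    (transverse Q C F).face (faceTransverseEquiv Q C F F') =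
      transverse Q (C.face F'.1) (C.faceFaceEquiv F'.1 ⟨F, F'.2⟩) := by
  have hp : Q.proj ((C.face F'.1).face (C.faceFaceEquiv F'.1 ⟨F, F'.2⟩)).linSpan =
      Q.proj (C.face F).linSpan := Q.proj_congr (by rw [face_faceFaceEquiv])
  refine LatticeCone.ext ?_ ?_
  · change F'.1.1.map (Q.proj (C.face F).linSpan) = F'.1.1.map _
    rw [hp]
  · refine Eq.trans ?_ (congrArg (fun f : RInf →ₗ[ℝ] RInf =>
      (C.face F'.1).lattice.map (f.restrictScalars ℤ)) hp.symm)
    refine le_antisymm ?_ ?_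
    · rintro _ ⟨⟨x, hx, rfl⟩, h⟩
      have h' : Q.proj (C.face F).linSpan x ∈
          (C.face F'.1).linSpan.map (Q.proj (C.face F).linSpan) :=
        linSpan_face_faceTransverseEquiv Q C F F' ▸ h
      obtain ⟨z, hz, hzx⟩ := h'
      have hxz := (Q.proj_eq_iff_sub_mem (C.face F).linSpan).1 hzx.symm
      refine ⟨x, ⟨hx, ?_⟩, rfl⟩
      rw [← sub_add_cancel x z]
      exact Submodule.add_mem _ (Submodule.span_mono F'.2 hxz) hz
    · rintro _ ⟨x, hx, rfl⟩
      refine ⟨⟨x, hx.1, rfl⟩, ?_⟩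
      change _ ∈ ((transverse Q C F).face (faceTransverseEquiv Q C F F')).linSpan
      rw [linSpan_face_faceTransverseEquiv]
      exact ⟨x, hx.2, rfl⟩

/-! ### Faces of Minkowski products -/

/-- By positive definiteness, orthogonal subspaces meet only in `0`, so decompositions along them
are unique. -/
lemma Orth.eq_of_add_eq {Q : RatInnerProduct} {C D : LatticeCone} (h : Orth Q C D)
    {x x' y y' : RInf} (hx : x ∈ C.linSpan) (hx' : x' ∈ C.linSpan) (hy : y ∈ D.linSpan)
    (hy' : y' ∈ D.linSpan) (he : x + y = x' + y') : x = x' ∧ y = y' := by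
  have h1 : x - x' = y' - y := by
    rw [sub_eq_sub_iff_add_eq_add, he, add_comm]
  have h0 : x - x' = 0 := by
    by_contra hne
    exact (Q.pos _ hne).ne' (h.span (Submodule.sub_mem _ hx hx')
      (h1 ▸ Submodule.sub_mem _ hy' hy))
  exact ⟨sub_eq_zero.1 h0, (sub_eq_zero.1 (h1 ▸ h0)).symm⟩

/-- The faces of a product of orthogonal cones are the products of their faces. -/
def faceMulEquiv {Q : RatInnerProduct} {C D : LatticeCone} (h : Orth Q C D) :
    C.Face × D.Face ≃ (mul Q C D h).Face where
  toFun p := ⟨p.1.1 ⊔ p.2.1, by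
    refine ⟨sup_le_sup p.1.2.le p.2.2.le, fun {x y a} hx hy ha hxy => ?_⟩
    obtain ⟨c, hc, d, hd, rfl⟩ := Submodule.mem_sup.1 (show x ∈ C.cone ⊔ D.cone from hx)
    obtain ⟨c', hc', d', hd', rfl⟩ := Submodule.mem_sup.1 (show y ∈ C.cone ⊔ D.cone from hy)
    obtain ⟨f, hf, g, hg, he⟩ := Submodule.mem_sup.1 hxy
    have he' : f + g = (a • c + c') + (a • d + d') := by rw [he, smul_add]; abel
    have hcC := C.cone.add_mem (PointedCone.smul_mem _ ha.le hc) hc'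
    have hdD := D.cone.add_mem (PointedCone.smul_mem _ ha.le hd) hd'
    -- By uniqueness of components, membership in the sum of the faces can be tested in `C` and `D`
    -- separately.
    obtain ⟨h1, h2⟩ := h.eq_of_add_eq (C.cone_le_linSpan (p.1.2.le hf)) (C.cone_le_linSpan hcC)
      (D.cone_le_linSpan (p.2.2.le hg)) (D.cone_le_linSpan hdD) he'
    exact Submodule.add_mem_sup (p.1.2.mem_of_smul_add_mem hc hc' ha (h1 ▸ hf))
      (p.2.2.mem_of_smul_add_mem hd hd' ha (h2 ▸ hg))⟩
  invFun H := ⟨⟨H.1 ⊓ C.cone, by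
      have := H.2.inf (PointedCone.IsFaceOf.refl C.cone)
      rwa [inf_eq_right.2 (show C.cone ≤ (mul Q C D h).cone from le_sup_left)] at this⟩,
    ⟨H.1 ⊓ D.cone, by
      have := H.2.inf (PointedCone.IsFaceOf.refl D.cone)
      rwa [inf_eq_right.2 (show D.cone ≤ (mul Q C D h).cone from le_sup_right)] at this⟩⟩
  left_inv p := by
    refine Prod.ext (Face.ext_val (le_antisymm ?_ fun x hx => ⟨Submodule.mem_sup_left hx, p.1.2.le hx⟩))
      (Face.ext_val (le_antisymm ?_ fun x hx => ⟨Submodule.mem_sup_right hx, p.2.2.le hx⟩))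
    · rintro x ⟨hx, hxC⟩
      obtain ⟨f, hf, g, hg, he⟩ := Submodule.mem_sup.1 hx
      have := (h.eq_of_add_eq (C.cone_le_linSpan (p.1.2.le hf)) (C.cone_le_linSpan hxC)
        (D.cone_le_linSpan (p.2.2.le hg)) (Submodule.zero_mem _) (by rw [he, add_zero])).1
      exact this ▸ hf
    · rintro x ⟨hx, hxD⟩
      obtain ⟨f, hf, g, hg, he⟩ := Submodule.mem_sup.1 hx
      have := (h.eq_of_add_eq (C.cone_le_linSpan (p.1.2.le hf)) (Submodule.zero_mem _)
        (D.cone_le_linSpan (p.2.2.le hg)) (D.cone_le_linSpan hxD) (by rw [he, zero_add])).2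
      exact this ▸ hg
  right_inv H := by
    refine Face.ext_val (le_antisymm (sup_le inf_le_left inf_le_left) fun x hx => ?_)
    -- Both components of a point of `H` lie in the product cone, so the face property puts each of
    -- them in `H`.
    obtain ⟨c, hc, d, hd, rfl⟩ := Submodule.mem_sup.1 (show x ∈ C.cone ⊔ D.cone from H.2.le hx)
    have hc' : c ∈ (mul Q C D h).cone := Submodule.mem_sup_left hc
    have hd' : d ∈ (mul Q C D h).cone := Submodule.mem_sup_right hd
    exact Submodule.add_mem_sup ⟨H.2.mem_of_add_mem_left hc' hd' hx, hc⟩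
      ⟨H.2.mem_of_add_mem_right hc' hd' hx, hd⟩

lemma orth_face {Q : RatInnerProduct} {C D : LatticeCone} (h : Orth Q C D) (F : C.Face)
    (G : D.Face) : Orth Q (C.face F) (D.face G) :=
  h.mono (C.linSpan_face_le F) (D.linSpan_face_le G)

lemma orth_transverse {Q : RatInnerProduct} {C D : LatticeCone} (h : Orth Q C D) (F : C.Face)
    (G : D.Face) : Orth Q (transverse Q C F) (transverse Q D G) :=
  h.mono (linSpan_transverse_le Q C F) (linSpan_transverse_le Q D G)

lemma linSpan_face_faceMulEquiv {Q : RatInnerProduct} {C D : LatticeCone} (h : Orth Q C D)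
    (p : C.Face × D.Face) : ((mul Q C D h).face (faceMulEquiv h p)).linSpan =
      (C.face p.1).linSpan ⊔ (D.face p.2).linSpan :=
  linSpan_mul (orth_face h p.1 p.2)

/-- An element of `Λ_C + Λ_D` lying in `lin F + lin G` has its components in `lin F` and `lin G`, by
uniqueness of the decomposition. -/
lemma face_faceMulEquiv {Q : RatInnerProduct} {C D : LatticeCone} (h : Orth Q C D)
    (p : C.Face × D.Face) :
    (mul Q C D h).face (faceMulEquiv h p) =
      mul Q (C.face p.1) (D.face p.2) (orth_face h p.1 p.2) := by
  refine LatticeCone.ext rfl (le_antisymm ?_ ?_)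
  · rintro x ⟨hx, hx'⟩
    obtain ⟨c, hc, d, hd, rfl⟩ :=
      Submodule.mem_sup.1 (show x ∈ C.lattice ⊔ D.lattice from hx)
    have hx2 : c + d ∈ (C.face p.1).linSpan ⊔ (D.face p.2).linSpan :=
      linSpan_face_faceMulEquiv h p ▸ hx'
    obtain ⟨f, hf, g, hg, he⟩ := Submodule.mem_sup.1 hx2
    obtain ⟨rfl, rfl⟩ := h.eq_of_add_eq (C.linSpan_face_le _ hf) (C.lattice_le_linSpan hc)
      (D.linSpan_face_le _ hg) (D.lattice_le_linSpan hd) he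
    exact Submodule.add_mem_sup ⟨hc, hf⟩ ⟨hd, hg⟩
  · refine sup_le (fun x hx => ⟨Submodule.mem_sup_left hx.1, ?_⟩)
      fun x hx => ⟨Submodule.mem_sup_right hx.1, ?_⟩
    · exact Submodule.span_mono (fun _ h => Submodule.mem_sup_left h) hx.2
    · exact Submodule.span_mono (fun _ h => Submodule.mem_sup_right h) hx.2

/-- Since `lin G` is orthogonal to `lin C`, projecting along `lin F + lin G` acts on `lin C` as
projecting along `lin F`; symmetrically on `lin D`. -/
lemma transverse_faceMulEquiv {Q : RatInnerProduct} {C D : LatticeCone} (h : Orth Q C D)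
    (p : C.Face × D.Face) :
    transverse Q (mul Q C D h) (faceMulEquiv h p) =
      mul Q (transverse Q C p.1) (transverse Q D p.2) (orth_transverse h p.1 p.2) := by
  have hC : ∀ x ∈ C.linSpan, Q.proj ((mul Q C D h).face (faceMulEquiv h p)).linSpan x =
      Q.proj (C.face p.1).linSpan x := fun x hx =>
    Q.proj_sup (linSpan_face_faceMulEquiv h p) (fun _ hw _ hv => (orth_face h p.1 p.2).span hw hv)
      fun v hv => h.span hx (D.linSpan_face_le _ hv)
  have hD : ∀ x ∈ D.linSpan, Q.proj ((mul Q C D h).face (faceMulEquiv h p)).linSpan x =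
      Q.proj (D.face p.2).linSpan x := fun x hx =>
    Q.proj_sup ((linSpan_face_faceMulEquiv h p).trans (sup_comm _ _))
      (fun _ hw _ hv => (orth_face h p.1 p.2).symm.span hw hv)
      fun v hv => h.symm.span hx (C.linSpan_face_le _ hv)
  refine LatticeCone.ext ?_ ?_
  · refine (Submodule.map_sup _ _ _).trans (congrArg₂ (· ⊔ ·) ?_ ?_)
    · exact SetLike.coe_injective (Set.image_congr fun x hx => hC x (C.cone_le_linSpan hx))
    · exact SetLike.coe_injective (Set.image_congr fun x hx => hD x (D.cone_le_linSpan hx))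
  · refine (Submodule.map_sup _ _ _).trans (congrArg₂ (· ⊔ ·) ?_ ?_)
    · exact SetLike.coe_injective (Set.image_congr fun x hx => hC x (C.lattice_le_linSpan hx))
    · exact SetLike.coe_injective (Set.image_congr fun x hx => hD x (D.lattice_le_linSpan hx))

end LatticeCone

open LatticeCone

/-! ### The space of lattice cones -/

lemma bilin_expand {V : Type*} [AddCommGroup V] [Module ℚ V]
    (f : ConeSpace →ₗ[ℚ] ConeSpace →ₗ[ℚ] V) (x y : ConeSpace) :
    f x y = ∑ C ∈ x.support, ∑ D ∈ y.support,
      (x C * y D) • f (Finsupp.single C 1) (Finsupp.single D 1) := by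
  have hx : ∀ z : ConeSpace, z = ∑ C ∈ z.support, z C • Finsupp.single C (1 : ℚ) := fun z => by
    conv_lhs => rw [← Finsupp.sum_single z]
    simp [Finsupp.sum]
  conv_lhs => rw [hx x, hx y]
  simp only [map_sum, LinearMap.sum_apply, map_smul, LinearMap.smul_apply, Finset.smul_sum,
    smul_smul]
  rw [Finset.sum_comm]
  simp only [mul_comm]

/-- Bilinear maps that agree on orthogonal pairs of lattice cones agree on related pairs. -/
lemma bilin_eq_of_coneTop {Q : RatInnerProduct} {V : Type*} [AddCommGroup V] [Module ℚ V]
    {f g : ConeSpace →ₗ[ℚ] ConeSpace →ₗ[ℚ] V}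
    (h : ∀ C D, Orth Q C D → f (Finsupp.single C 1) (Finsupp.single D 1) =
      g (Finsupp.single C 1) (Finsupp.single D 1)) {x y : ConeSpace} (hxy : coneTop Q x y) :
    f x y = g x y := by
  rw [bilin_expand f, bilin_expand g]
  exact Finset.sum_congr rfl fun C hC => Finset.sum_congr rfl fun D hD => by
    rw [h C D (hxy C hC D hD)]

lemma coneTop_single {Q : RatInnerProduct} {C D : LatticeCone} (h : Orth Q C D) (a b : ℚ) :
    coneTop Q (Finsupp.single C a) (Finsupp.single D b) := by
  intro C' hC' D' hD'
  rw [Finset.mem_singleton.1 (Finsupp.support_single_subset hC'),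
    Finset.mem_singleton.1 (Finsupp.support_single_subset hD')]
  exact h

lemma coneTop_symm {Q : RatInnerProduct} {x y : ConeSpace} (h : coneTop Q x y) :
    coneTop Q y x := fun C hC D hD => (h D hD C hC).symm

lemma mulAux_single_of_orth {Q : RatInnerProduct} {C D : LatticeCone} (h : Orth Q C D) (a b : ℚ) :
    mulAux Q (Finsupp.single C a) (Finsupp.single D b) =
      Finsupp.single (LatticeCone.mul Q C D h) (a * b) := by
  simp [mulAux, h]

lemma mulAux_single_of_not_orth {Q : RatInnerProduct} {C D : LatticeCone} (h : ¬ Orth Q C D)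
    (a b : ℚ) : mulAux Q (Finsupp.single C a) (Finsupp.single D b) = 0 := by
  simp [mulAux, h]

/-- Cancellation can only shrink the support, and this inclusion is all that the locality statements
need. -/
lemma exists_of_mem_support_mulAux {Q : RatInnerProduct} {x y : ConeSpace} {E : LatticeCone}
    (h : E ∈ (mulAux Q x y).support) :
    ∃ C ∈ x.support, ∃ D ∈ y.support, ∃ h : Orth Q C D, E = LatticeCone.mul Q C D h := by
  classical
  rw [bilin_expand] at h
  obtain ⟨C, hC, h⟩ := Finset.mem_biUnion.1 (Finsupp.support_finsetSum h)
  obtain ⟨D, hD, h⟩ := Finset.mem_biUnion.1 (Finsupp.support_finsetSum h)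
  refine ⟨C, hC, D, hD, ?_⟩
  by_cases hCD : Orth Q C D
  · rw [mulAux_single_of_orth hCD] at h
    exact ⟨hCD, Finset.mem_singleton.1 (Finsupp.support_single_subset (Finsupp.support_smul h))⟩
  · simp [mulAux_single_of_not_orth hCD] at h

lemma mulAux_comm (Q : RatInnerProduct) (x y : ConeSpace) : mulAux Q x y = mulAux Q y x := by
  induction x using Finsupp.induction_linear with
  | zero => simp
  | add x x' hx hx' => simp [hx, hx']
  | single C a =>
    induction y using Finsupp.induction_linear with
    | zero => simp
    | add y y' hy hy' => simp [hy, hy']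
    | single D b =>
      by_cases h : Orth Q C D
      · rw [mulAux_single_of_orth h, mulAux_single_of_orth h.symm, mul_comm' h, mul_comm]
      · rw [mulAux_single_of_not_orth h, mulAux_single_of_not_orth fun h' => h h'.symm]

/-- Associativity holds on all of `ℚ𝒞`: both products vanish on lattice cones that are not
pairwise orthogonal. -/
lemma mulAux_assoc (Q : RatInnerProduct) (x y z : ConeSpace) :
    mulAux Q (mulAux Q x y) z = mulAux Q x (mulAux Q y z) := by
  induction x using Finsupp.induction_linear with
  | zero => simp
  | add x x' hx hx' => simp [hx, hx']
  | single C a =>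
  induction y using Finsupp.induction_linear with
  | zero => simp
  | add y y' hy hy' => simp [hy, hy']
  | single D b =>
  induction z using Finsupp.induction_linear with
  | zero => simp
  | add z z' hz hz' => simp [hz, hz']
  | single E c =>
  by_cases h : Orth Q C D <;> by_cases h' : Orth Q D E
  · rw [mulAux_single_of_orth h, mulAux_single_of_orth h']
    by_cases h'' : Orth Q C E
    · rw [mulAux_single_of_orth ((orth_mul_left h).2 ⟨h'', h'⟩),
        mulAux_single_of_orth ((orth_mul_right h').2 ⟨h, h''⟩), mul_assoc' h _ h', mul_assoc]
    · rw [mulAux_single_of_not_orth fun H => h'' ((orth_mul_left h).1 H).1,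
        mulAux_single_of_not_orth fun H => h'' ((orth_mul_right h').1 H).2]
  · rw [mulAux_single_of_orth h, mulAux_single_of_not_orth h', map_zero,
      mulAux_single_of_not_orth fun H => h' ((orth_mul_left h).1 H).2]
  · rw [mulAux_single_of_orth h', mulAux_single_of_not_orth h, map_zero, LinearMap.zero_apply,
      mulAux_single_of_not_orth fun H => h ((orth_mul_right h').1 H).1]
  · rw [mulAux_single_of_not_orth h, mulAux_single_of_not_orth h', map_zero, map_zero,
      LinearMap.zero_apply]

lemma mulAux_one (Q : RatInnerProduct) (x : ConeSpace) : mulAux Q x coneOne = x := by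
  induction x using Finsupp.induction_linear with
  | zero => simp
  | add x x' hx hx' => simp [hx, hx']
  | single C a => rw [coneOne, mulAux_single_of_orth (orth_unit_right Q C), mul_unit, mul_one]

lemma one_mulAux (Q : RatInnerProduct) (x : ConeSpace) : mulAux Q coneOne x = x := by
  rw [mulAux_comm, mulAux_one]

lemma coneTop_mulAux {Q : RatInnerProduct} {u x y : ConeSpace} (hx : coneTop Q u x)
    (hy : coneTop Q u y) : coneTop Q u (mulAux Q x y) := by
  intro E hE K hK
  obtain ⟨C, hC, D, hD, h, rfl⟩ := exists_of_mem_support_mulAux hK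
  exact (orth_mul_right h).2 ⟨hx E hE C hC, hy E hE D hD⟩

lemma isLocalityVectorSpace (Q : RatInnerProduct) : IsLocalityVectorSpace ℚ (coneTop Q) where
  symm _ _ := coneTop_symm
  polar_subspace X := by
    -- A polar set is spanned by basis elements: those orthogonal to every lattice cone occurring in
    -- an element of `X`.
    refine ⟨Finsupp.supported ℚ ℚ {D | ∀ u ∈ X, ∀ C ∈ u.support, Orth Q C D}, Set.ext fun x => ?_⟩
    rw [SetLike.mem_coe, Finsupp.mem_supported]
    exact ⟨fun h u hu C hC D hD => h hD u hu C hC, fun h D hD u hu C hC => h u hu C hC D hD⟩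

lemma isLocalityAlgebra (Q : RatInnerProduct) :
    IsLocalityAlgebra ℚ (coneTop Q) (coneMul Q) coneOne where
  vectorSpace := isLocalityVectorSpace Q
  bilinear :=
    { add_left := fun v₁ v₂ w _ _ _ => by simp [coneMul]
      add_right := fun v w₁ w₂ _ _ _ => by simp [coneMul]
      smul_left := fun k v w _ _ => by simp [coneMul]
      smul_right := fun k v w _ _ => by simp [coneMul] }
  monoid :=
    { symm := fun _ _ => coneTop_symm
      mul_mem_polar := fun U x y _ hx hy u hu => coneTop_mulAux (hx u hu) (hy u hu)
      assoc := fun x y z _ _ _ _ _ => mulAux_assoc Q x y z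
      polar_one := by
        refine Set.eq_univ_of_forall fun x u hu C hC D _ => ?_
        rw [Set.mem_singleton_iff.1 hu] at hC
        rw [Finset.mem_singleton.1 (Finsupp.support_single_subset hC)]
        exact orth_unit_left Q D
      mul_one := fun x _ => mulAux_one Q x
      one_mul := fun x _ => one_mulAux Q x }
  comm x y _ _ := mulAux_comm Q x y

/-! ### The coproduct -/

lemma coneComul_single (Q : RatInnerProduct) (C : LatticeCone) (a : ℚ) :
    coneComul Q (Finsupp.single C a) = ∑ F : C.Face,
      Finsupp.single (transverse Q C F) a ⊗ₜ[ℚ] Finsupp.single (C.face F) (1 : ℚ) := by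
  simp only [coneComul, Finsupp.linearCombination_single, Finset.smul_sum, TensorProduct.smul_tmul',
    Finsupp.smul_single_one]

/-- An expression of the coproduct by pure tensors of multiples of basis elements, with the
coefficient on the left. It witnesses the locality of the coproduct and the relatedness of two
coproducts. -/
lemma coneComul_eq_sum (Q : RatInnerProduct) (x : ConeSpace) :
    coneComul Q x = ∑ p : Σ C : x.support, C.1.Face,
      Finsupp.single (transverse Q p.1.1 p.2) (x p.1.1) ⊗ₜ[ℚ]
        Finsupp.single (p.1.1.face p.2) (1 : ℚ) := by
  conv_lhs => rw [← Finsupp.sum_single x, Finsupp.sum, map_sum]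
  rw [Fintype.sum_sigma, ← Finset.sum_coe_sort x.support]
  exact Finset.sum_congr rfl fun C _ => coneComul_single Q _ _

lemma coneCounit_single (C : LatticeCone) (a : ℚ) [Decidable (C = unit)] :
    coneCounit (Finsupp.single C a) = if C = unit then a else 0 := by
  simp [coneCounit]

/-- Exchanges the two ways of summing over flags `F ≤ F'`; the summand may depend on the proof of
the relation. -/
lemma sum_subtype_comm {ι M : Type*} [Fintype ι] [AddCommMonoid M] (r : ι → ι → Prop)
    [DecidableRel r] (f : ∀ i j, r i j → M) :
    ∑ i, ∑ j : {j // r i j}, f i j.1 j.2 = ∑ j, ∑ i : {i // r i j}, f i.1 j i.2 := by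
  rw [← Fintype.sum_sigma', ← Fintype.sum_sigma']
  exact Fintype.sum_equiv
    ⟨fun p => ⟨p.2.1, ⟨p.1, p.2.2⟩⟩, fun p => ⟨p.2.1, ⟨p.1, p.2.2⟩⟩,
      fun _ => rfl, fun _ => rfl⟩ _ _ fun _ => rfl

/-- The left side sums over `F` and then over the faces above it, the right side over `F'` and then
over the faces below it. The face bijections turn both into the same sum over flags. -/
lemma coneComul_coassoc (Q : RatInnerProduct) (x : ConeSpace) :
    TensorProduct.assoc ℚ ConeSpace ConeSpace ConeSpace
      (((coneComul Q).rTensor ConeSpace) (coneComul Q x)) =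
      ((coneComul Q).lTensor ConeSpace) (coneComul Q x) := by
  classical
  induction x using Finsupp.induction_linear with
  | zero => simp
  | add x y hx hy => simp only [map_add, hx, hy]
  | single C a =>
    simp only [coneComul_single, map_sum, LinearMap.rTensor_tmul, LinearMap.lTensor_tmul,
      TensorProduct.sum_tmul, TensorProduct.tmul_sum, TensorProduct.assoc_tmul]
    calc _ = ∑ F : C.Face, ∑ F' : {F' : C.Face // F.1 ≤ F'.1},
          Finsupp.single (transverse Q C F'.1) a ⊗ₜ[ℚ]
            (Finsupp.single (transverse Q (C.face F'.1) (C.faceFaceEquiv F'.1 ⟨F, F'.2⟩)) (1 : ℚ)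
              ⊗ₜ[ℚ] Finsupp.single (C.face F) (1 : ℚ)) :=
          Finset.sum_congr rfl fun F _ => by
            rw [← (faceTransverseEquiv Q C F).sum_comp]
            simp only [transverse_faceTransverseEquiv, face_faceTransverseEquiv]
      _ = ∑ F' : C.Face, ∑ F : {F : C.Face // F.1 ≤ F'.1},
          Finsupp.single (transverse Q C F') a ⊗ₜ[ℚ]
            (Finsupp.single (transverse Q (C.face F') (C.faceFaceEquiv F' F)) (1 : ℚ)
              ⊗ₜ[ℚ] Finsupp.single (C.face F.1) (1 : ℚ)) := by
          exact sum_subtype_comm (fun F F' : C.Face => F.1 ≤ F'.1) fun F F' hF =>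
            Finsupp.single (transverse Q C F') a ⊗ₜ[ℚ]
              (Finsupp.single (transverse Q (C.face F') (C.faceFaceEquiv F' ⟨F, hF⟩)) (1 : ℚ)
                ⊗ₜ[ℚ] Finsupp.single (C.face F) (1 : ℚ))
      _ = _ := Finset.sum_congr rfl fun F' _ => by
          rw [← (C.faceFaceEquiv F').sum_comp]
          simp only [face_faceFaceEquiv]

/-- Only `F = C` has a trivial transverse cone, so a single term survives; on the other side only `F
= {0}` does. -/
lemma coneCounit_rTensor (Q : RatInnerProduct) (x : ConeSpace) :
    TensorProduct.lid ℚ ConeSpace ((coneCounit.rTensor ConeSpace) (coneComul Q x)) = x := by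
  classical
  induction x using Finsupp.induction_linear with
  | zero => simp
  | add x y hx hy => simp only [map_add, hx, hy]
  | single C a =>
    simp only [coneComul_single, map_sum, LinearMap.rTensor_tmul, TensorProduct.lid_tmul,
      coneCounit_single, transverse_eq_unit_iff]
    rw [Fintype.sum_eq_single ⊤ fun F hF => by rw [if_neg hF, zero_smul]]
    simp [face_top]

lemma coneCounit_lTensor (Q : RatInnerProduct) (x : ConeSpace) :
    TensorProduct.rid ℚ ConeSpace ((coneCounit.lTensor ConeSpace) (coneComul Q x)) = x := by
  classical
  induction x using Finsupp.induction_linear with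
  | zero => simp
  | add x y hx hy => simp only [map_add, hx, hy]
  | single C a =>
    simp only [coneComul_single, map_sum, LinearMap.lTensor_tmul, TensorProduct.rid_tmul,
      coneCounit_single, face_eq_unit_iff]
    rw [Fintype.sum_eq_single ⊥ fun F hF => by rw [if_neg hF, zero_smul]]
    simp [transverse_bot]

lemma isLocalityCoalgebra (Q : RatInnerProduct) :
    IsLocalityCoalgebra ℚ (coneTop Q) (coneComul Q) coneCounit where
  vectorSpace := isLocalityVectorSpace Q
  comul_mem U x hx := by
    rw [coneComul_eq_sum]
    refine Submodule.sum_mem _ fun p _ => Submodule.subset_span ⟨_, ?_, _, ?_,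
      coneTop_single (orth_transverse_face Q _ _) _ _, rfl⟩
    · intro u hu C hC D hD
      rw [Finset.mem_singleton.1 (Finsupp.support_single_subset hD)]
      exact (hx u hu C hC _ p.1.2).mono le_rfl (linSpan_transverse_le Q _ _)
    · intro u hu C hC D hD
      rw [Finset.mem_singleton.1 (Finsupp.support_single_subset hD)]
      exact (hx u hu C hC _ p.1.2).mono le_rfl (linSpan_face_le _ _)
  coassoc := coneComul_coassoc Q
  counit_left := coneCounit_rTensor Q
  counit_right := coneCounit_lTensor Q

/-! ### Compatibility of product and coproduct -/

lemma tensorTop_sum {K B : Type*} [Field K] [AddCommGroup B] [Module K B] {top : B → B → Prop}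
    {ι κ : Type*} [Fintype ι] [Fintype κ] {a b : ι → B} {c d : κ → B} (hab : ∀ i, top (a i) (b i))
    (hcd : ∀ j, top (c j) (d j))
    (h : ∀ i j, top (a i) (c j) ∧ top (a i) (d j) ∧ top (b i) (c j) ∧ top (b i) (d j)) :
    tensorTop K top (∑ i, a i ⊗ₜ[K] b i) (∑ j, c j ⊗ₜ[K] d j) :=
  ⟨Fintype.card ι, Fintype.card κ, a ∘ (Fintype.equivFin ι).symm, b ∘ (Fintype.equivFin ι).symm,
    c ∘ (Fintype.equivFin κ).symm, d ∘ (Fintype.equivFin κ).symm,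
    ⟨fun _ => hab _, fun _ => hcd _, fun _ _ => h _ _⟩,
    ((Fintype.equivFin ι).symm.sum_comp fun i => a i ⊗ₜ[K] b i).symm,
    ((Fintype.equivFin κ).symm.sum_comp fun j => c j ⊗ₜ[K] d j).symm⟩

/-- The right side is bilinear in the coproducts as tensors, so it does not depend on how they are
written as sums of pure tensors. It thus suffices to compare orthogonal basis elements, where the
faces of the product are pairs of faces. -/
lemma coneComul_mulAux {Q : RatInnerProduct} {x y : ConeSpace} (h : coneTop Q x y) :
    coneComul Q (mulAux Q x y) =
      TensorProduct.map₂ (mulAux Q) (mulAux Q) (coneComul Q x) (coneComul Q y) := by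
  have key := bilin_eq_of_coneTop (f := (mulAux Q).compr₂ (coneComul Q))
    (g := (TensorProduct.map₂ (mulAux Q) (mulAux Q)).compl₁₂ (coneComul Q) (coneComul Q))
    (fun C D hCD => ?_) h
  · rwa [LinearMap.compr₂_apply, LinearMap.compl₁₂_apply] at key
  rw [LinearMap.compr₂_apply, LinearMap.compl₁₂_apply, mulAux_single_of_orth hCD]
  simp only [coneComul_single, map_sum, LinearMap.sum_apply, TensorProduct.map₂_apply_tmul]
  rw [← (faceMulEquiv hCD).sum_comp, Fintype.sum_prod_type, Finset.sum_comm]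
  refine Finset.sum_congr rfl fun G _ => Finset.sum_congr rfl fun F _ => ?_
  rw [face_faceMulEquiv, transverse_faceMulEquiv, TensorProduct.map_tmul,
    mulAux_single_of_orth (orth_transverse hCD F G), mulAux_single_of_orth (orth_face hCD F G), one_mul]

lemma coneCounit_mulAux {Q : RatInnerProduct} {x y : ConeSpace} (h : coneTop Q x y) :
    coneCounit (mulAux Q x y) = coneCounit x * coneCounit y := by
  classical
  refine bilin_eq_of_coneTop (f := (mulAux Q).compr₂ coneCounit)
    (g := (LinearMap.mul ℚ ℚ).compl₁₂ coneCounit coneCounit) (fun C D hCD => ?_) h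
  rw [LinearMap.compr₂_apply, LinearMap.compl₁₂_apply, mulAux_single_of_orth hCD]
  simp only [coneCounit_single, mul_eq_unit_iff, LinearMap.mul_apply']
  by_cases hC : C = unit <;> by_cases hD : D = unit <;> simp [hC, hD]

lemma coneComul_one (Q : RatInnerProduct) : coneComul Q coneOne = coneOne ⊗ₜ[ℚ] coneOne := by
  have hF : ∀ F : unit.Face, F ≠ ⊥ → False := fun F hF => hF (Face.ext_val (le_bot_iff.1 F.2.le))
  rw [coneOne, coneComul_single, Fintype.sum_eq_single ⊥ fun F h => (hF F h).elim, transverse_bot,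
    face_bot]

lemma isLocalityBialgebra (Q : RatInnerProduct) :
    IsLocalityBialgebra ℚ (coneTop Q) (coneMul Q) coneOne (coneComul Q) coneCounit where
  algebra := isLocalityAlgebra Q
  coalgebra := isLocalityCoalgebra Q
  comul_top x y h := by
    rw [coneComul_eq_sum, coneComul_eq_sum]
    refine tensorTop_sum (fun p => coneTop_single (orth_transverse_face Q _ _) _ _)
      (fun p => coneTop_single (orth_transverse_face Q _ _) _ _) fun p q => ?_
    have hpq : Orth Q p.1.1 q.1.1 := h _ p.1.2 _ q.1.2
    exact ⟨coneTop_single (orth_transverse hpq _ _) _ _,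
      coneTop_single (hpq.mono (linSpan_transverse_le Q _ _) (linSpan_face_le _ _)) _ _,
      coneTop_single (hpq.mono (linSpan_face_le _ _) (linSpan_transverse_le Q _ _)) _ _,
      coneTop_single (orth_face hpq _ _) _ _⟩
  comul_mul x y h m n a b c d H hx hy := by
    change coneComul Q (mulAux Q x y) = _
    rw [coneComul_mulAux h, hx, hy]
    simp only [map_sum, LinearMap.sum_apply, TensorProduct.map₂_apply_tmul]
    rw [Finset.sum_comm]
    rfl
  comul_one := coneComul_one Q
  counit_mul x y h := coneCounit_mulAux h
  counit_one := by
    classical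
    rw [coneOne, coneCounit_single, if_pos rfl]

/-! ### The antipode -/

/-- The convolution product of linear endomorphisms of `ℚ𝒞`. -/
def conv (Q : RatInnerProduct) (f g : ConeSpace →ₗ[ℚ] ConeSpace) : ConeSpace →ₗ[ℚ] ConeSpace :=
  TensorProduct.lift (mulAux Q) ∘ₗ TensorProduct.map f g ∘ₗ coneComul Q

lemma conv_single (Q : RatInnerProduct) (f g : ConeSpace →ₗ[ℚ] ConeSpace) (C : LatticeCone) :
    conv Q f g (Finsupp.single C 1) = ∑ F : C.Face,
      mulAux Q (f (Finsupp.single (transverse Q C F) 1)) (g (Finsupp.single (C.face F) 1)) := by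
  simp only [conv, LinearMap.comp_apply, coneComul_single, map_sum, TensorProduct.map_tmul,
    TensorProduct.lift.tmul]

/-- Coassociativity together with associativity of the product extended by zero: no locality
condition on the three maps is needed. -/
lemma conv_assoc (Q : RatInnerProduct) (f g h : ConeSpace →ₗ[ℚ] ConeSpace) :
    conv Q (conv Q f g) h = conv Q f (conv Q g h) := by
  have key : (TensorProduct.lift (mulAux Q) ∘ₗ
      TensorProduct.map (TensorProduct.lift (mulAux Q) ∘ₗ TensorProduct.map f g) h) =
      (TensorProduct.lift (mulAux Q) ∘ₗ
        TensorProduct.map f (TensorProduct.lift (mulAux Q) ∘ₗ TensorProduct.map g h)) ∘ₗ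
        (TensorProduct.assoc ℚ ConeSpace ConeSpace ConeSpace).toLinearMap :=
    TensorProduct.ext_threefold fun x y z => by simp [mulAux_assoc]
  refine LinearMap.ext fun x => ?_
  have h1 : TensorProduct.map (conv Q f g) h =
      TensorProduct.map (TensorProduct.lift (mulAux Q) ∘ₗ TensorProduct.map f g) h ∘ₗ
        (coneComul Q).rTensor ConeSpace := by
    rw [LinearMap.map_comp_rTensor]; rfl
  have h2 : TensorProduct.map f (conv Q g h) =
      TensorProduct.map f (TensorProduct.lift (mulAux Q) ∘ₗ TensorProduct.map g h) ∘ₗ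
        (coneComul Q).lTensor ConeSpace := by
    rw [LinearMap.map_comp_lTensor]; rfl
  calc _ = TensorProduct.lift (mulAux Q) (TensorProduct.map (conv Q f g) h (coneComul Q x)) := rfl
    _ = _ := by
      rw [h1, LinearMap.comp_apply, ← LinearMap.comp_apply (TensorProduct.lift _), key,
        LinearMap.comp_apply, LinearEquiv.coe_coe, coneComul_coassoc, LinearMap.comp_apply,
        ← LinearMap.comp_apply (TensorProduct.map _ _), ← h2]
      rfl

lemma one_conv (Q : RatInnerProduct) (f : ConeSpace →ₗ[ℚ] ConeSpace) :
    conv Q (coneCounit.smulRight coneOne) f = f := by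
  have key : TensorProduct.lift (mulAux Q) ∘ₗ
      TensorProduct.map (coneCounit.smulRight coneOne) f =
      f ∘ₗ (TensorProduct.lid ℚ ConeSpace).toLinearMap ∘ₗ coneCounit.rTensor ConeSpace :=
    TensorProduct.ext' fun x y => by simp [one_mulAux]
  refine LinearMap.ext fun x => (LinearMap.congr_fun key (coneComul Q x)).trans ?_
  exact congrArg f (coneCounit_rTensor Q x)

lemma conv_one (Q : RatInnerProduct) (f : ConeSpace →ₗ[ℚ] ConeSpace) :
    conv Q f (coneCounit.smulRight coneOne) = f := by
  have key : TensorProduct.lift (mulAux Q) ∘ₗ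
      TensorProduct.map f (coneCounit.smulRight coneOne) =
      f ∘ₗ (TensorProduct.rid ℚ ConeSpace).toLinearMap ∘ₗ coneCounit.lTensor ConeSpace :=
    TensorProduct.ext' fun x y => by simp [mulAux_one]
  refine LinearMap.ext fun x => (LinearMap.congr_fun key (coneComul Q x)).trans ?_
  exact congrArg f (coneCounit_lTensor Q x)

open Classical in
/-- The antipode on lattice cones: `S(C) = ε(C) 1 - ∑_{F ≠ 0} S(t(C, F)) F`. -/
def antipodeCone (Q : RatInnerProduct) (C : LatticeCone) : ConeSpace :=
  (if C = unit then coneOne else 0) - ∑ F : C.Face,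
    if _h : F = ⊥ then 0
    else mulAux Q (antipodeCone Q (transverse Q C F)) (Finsupp.single (C.face F) 1)
termination_by Module.finrank ℝ C.linSpan
decreasing_by exact finrank_transverse_lt Q C F _h

/-- The antipode. -/
def antipode (Q : RatInnerProduct) : ConeSpace →ₗ[ℚ] ConeSpace :=
  Finsupp.linearCombination ℚ (antipodeCone Q)

lemma antipode_single (Q : RatInnerProduct) (C : LatticeCone) :
    antipode Q (Finsupp.single C 1) = antipodeCone Q C := by
  simp [antipode]

lemma antipode_one (Q : RatInnerProduct) : antipode Q coneOne = coneOne := by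
  have hF : ∀ F : unit.Face, F = ⊥ := fun F => Face.ext_val (le_bot_iff.1 F.2.le)
  rw [coneOne, antipode_single, antipodeCone]
  simp [hF, coneOne]

/-- The term of the convolution at `F = {0}` is `S(C)` itself, and the recursion is this identity
solved for that term. -/
lemma antipode_conv_id (Q : RatInnerProduct) :
    conv Q (antipode Q) LinearMap.id = coneCounit.smulRight coneOne := by
  classical
  refine Finsupp.lhom_ext' fun C => LinearMap.ext_ring ?_
  simp only [LinearMap.comp_apply, Finsupp.lsingle_apply, conv_single, antipode_single,
    LinearMap.id_apply, LinearMap.smulRight_apply, coneCounit_single, ite_smul, one_smul, zero_smul]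
  rw [← Finset.add_sum_erase _ _ (Finset.mem_univ (⊥ : C.Face)), transverse_bot, face_bot,
    ← coneOne, mulAux_one]
  conv_lhs => enter [1]; rw [antipodeCone]
  rw [← Finset.add_sum_erase _ _ (Finset.mem_univ (⊥ : C.Face)), dif_pos rfl, zero_add,
    sub_add_eq_add_sub, sub_eq_iff_eq_add]
  exact congrArg₂ (· + ·) (by congr) (Finset.sum_congr rfl fun F hF => by
    rw [dif_neg (Finset.ne_of_mem_erase hF)])

/-- Convolution on the left by the antipode is injective, since the antipode maps `1` to `1`. -/
lemma eq_zero_of_antipode_conv_eq_zero (Q : RatInnerProduct) (f : ConeSpace →ₗ[ℚ] ConeSpace)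
    (h : conv Q (antipode Q) f = 0) : f = 0 := by
  have key : ∀ n, ∀ C : LatticeCone, Module.finrank ℝ C.linSpan = n →
      f (Finsupp.single C 1) = 0 := by
    intro n
    induction n using Nat.strong_induction_on with
    | _ n ih =>
      intro C hC
      have hs := LinearMap.congr_fun h (Finsupp.single C 1)
      -- By induction `f` vanishes on proper faces, so only the term `S(1) · f(C) = f(C)` remains.
      rw [conv_single, Fintype.sum_eq_single ⊤ fun F hF => by
        rw [ih _ (hC ▸ finrank_face_lt C F hF) _ rfl, map_zero]] at hs
      rwa [transverse_top, face_top, ← coneOne, antipode_one, one_mulAux] at hs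
  exact Finsupp.lhom_ext' fun C => LinearMap.ext_ring (key _ C rfl)

/-- With `S ⋆ Id = u ∘ ε` one gets `S ⋆ (Id ⋆ S - u ∘ ε) = S - S = 0`, and left convolution by `S`
can be cancelled. -/
lemma id_conv_antipode (Q : RatInnerProduct) :
    conv Q LinearMap.id (antipode Q) = coneCounit.smulRight coneOne := by
  have hsub : ∀ f g h, conv Q f (g - h) = conv Q f g - conv Q f h := fun f g h => by
    rw [conv, conv, conv, ← LinearMap.comp_sub, ← LinearMap.sub_comp]
    congr 2
    exact TensorProduct.ext' fun x y => by simp [TensorProduct.tmul_sub]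
  refine sub_eq_zero.1 (eq_zero_of_antipode_conv_eq_zero Q _ ?_)
  rw [hsub, ← conv_assoc, antipode_conv_id, one_conv, conv_one, sub_self]

/-- Induction on dimension: each factor in the recursion has its span in `lin C`. Anything
orthogonal to `C` is therefore orthogonal to `S(C)`. -/
lemma linSpan_le_of_mem_support_antipodeCone (Q : RatInnerProduct) (C : LatticeCone) :
    ∀ D ∈ (antipodeCone Q C).support, D.linSpan ≤ C.linSpan := by
  classical
  induction hn : Module.finrank ℝ C.linSpan using Nat.strong_induction_on generalizing C with
  | _ n ih =>
    suffices h : antipodeCone Q C ∈ Finsupp.supported ℚ ℚ {D | D.linSpan ≤ C.linSpan} from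
      fun D hD => (Finsupp.mem_supported ℚ _).1 h hD
    rw [antipodeCone]
    refine Submodule.sub_mem _ ?_ (Submodule.sum_mem _ fun F _ => ?_)
    · split_ifs
      · exact Finsupp.single_mem_supported ℚ 1 (by simp [linSpan_unit])
      · exact Submodule.zero_mem _
    · split_ifs with hF
      · exact Submodule.zero_mem _
      · rw [Finsupp.mem_supported]
        intro D hD
        obtain ⟨A, hA, B, hB, h, rfl⟩ := exists_of_mem_support_mulAux hD
        obtain rfl := Finset.mem_singleton.1 (Finsupp.support_single_subset hB)
        have hA' := ih _ (hn ▸ finrank_transverse_lt Q C F hF) _ rfl A hA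
        exact (linSpan_mul h).trans_le <|
          sup_le (hA'.trans (linSpan_transverse_le Q C F)) (C.linSpan_face_le F)

lemma coneTop_antipode {Q : RatInnerProduct} {x y : ConeSpace} (h : coneTop Q x y) :
    coneTop Q (antipode Q x) y := by
  classical
  intro C hC D hD
  rw [antipode, Finsupp.linearCombination_apply, Finsupp.sum] at hC
  obtain ⟨E, hE, hC⟩ := Finset.mem_biUnion.1 (Finsupp.support_finsetSum hC)
  exact (h E hE D hD).mono
    (linSpan_le_of_mem_support_antipodeCone Q E C (Finsupp.support_smul hC)) le_rfl

/-- `conv` applies a linear map to the tensor `Δ x`, so every admissible expression of `Δ x` gives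
the same value. -/
lemma isConvolution_of_conv_eq {Q : RatInnerProduct} {f g χ : ConeSpace →ₗ[ℚ] ConeSpace}
    (h : Independent (coneTop Q) (coneTop Q) f g) (hχ : conv Q f g = χ) :
    IsConvolution ℚ (coneTop Q) (coneMul Q) (coneComul Q) f g h χ := by
  intro x n a b H hx
  rw [← hχ, conv, LinearMap.comp_apply, LinearMap.comp_apply, hx]
  simp only [map_sum, TensorProduct.map_tmul, TensorProduct.lift.tmul]
  rfl

lemma isAntipode (Q : RatInnerProduct) :
    IsAntipode ℚ (coneTop Q) (coneMul Q) coneOne (coneComul Q) coneCounit (antipode Q) :=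
  ⟨fun _ _ h => coneTop_antipode h, fun _ _ h => coneTop_symm (coneTop_antipode (coneTop_symm h)),
    isConvolution_of_conv_eq _ (antipode_conv_id Q), isConvolution_of_conv_eq _ (id_conv_antipode Q)⟩

end

end LocalityCone

theorem corollary5p6 (Q : LocalityCone.RatInnerProduct) :
    LocalityCone.IsLocalityHopfAlgebra ℚ (LocalityCone.coneTop Q) (LocalityCone.coneMul Q)
      LocalityCone.coneOne (LocalityCone.coneComul Q) LocalityCone.coneCounit :=
  ⟨LocalityCone.isLocalityBialgebra Q, LocalityCone.antipode Q, LocalityCone.isAntipode Q⟩
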